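/- Let $\Omega,\tilde\Omega\subset\mathbb{R}^n$ be bounded, uniformly convex domains with smooth boundary, with $\overline{\tilde\Omega}\subset B_1(0)$. Let $0<\alpha_0<1$, and let $u_0\in C^{2+\alpha_0}(\overline\Omega)$ be uniformly convex (i.e. $D^2u_0\ge\theta_0 I$ on $\overline\Omega$ for some $\theta_0>0$) with $Du_0(\Omega)=\tilde\Omega$. Then there is a constant $C_1>0$, depending only on $u_0$, $\Omega$ and $\tilde\Omega$, such that the following holds. Let $T>0$ and let $u$ be a strictly convex solution ($D^2u(x,t)>0$ for all $(x,t)\in\overline\Omega\times[0,T]$) of $$\frac{\partial u}{\partial t}=\sqrt{1-|Du|^2}\;\mathrm{div}\Big(\frac{Du}{\sqrt{1-|Du|^2}}\Big)\quad\text{in }\Omega\times(0,T),$$ $$Du(\cdot,t)(\Omega)=\tilde\Omega\quad\text{for }0<t\le T,\qquad u(\cdot,0)=u_0\quad\text{in }\Omega,$$ in the class $C^{2+\alpha,1+\frac{\alpha}{2}}(\overline\Omega\times[0,T])\cap C^{4+\alpha,2+\frac{\alpha}{2}}(\Omega\times(0,T))$ for some $\alpha\in(0,1)$. Let $h:\mathbb{R}^n\to\mathbb{R}$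 be any defining function of $\tilde\Omega$, that is, $h$ is smooth, $\tilde\Omega=\{p: h(p)>0\}$, $|Dh|=1$ on $\partial\tilde\Omega$, and $D^2h\le-\theta I$ in $\tilde\Omega$ for some $\theta>0$. Then for all $t\in[0,T]$ and $x\in\partial\Omega$, $$\langle\beta,\nu\rangle=\sum_{k=1}^n h_{p_k}(Du(x,t))\,\nu_k(x)\ \ge\ \frac{1}{C_1}>0,$$ where $\beta=Dh(Du)$ and $\nu$ is the unit inward normal of $\partial\Omega$. In particular $C_1$ is independent of $t$, $T$, $u$, $\alpha$ and $h$. -/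

import Mathlib

open Set
open scoped ContDiff Gradient RealInnerProductSpace

/-- Euclidean space `ℝⁿ`. -/
abbrev EucSp (n : ℕ) : Type := EuclideanSpace ℝ (Fin n)

/-- `ρ` is a smooth boundary defining function of `Ω`: `Ω = {ρ > 0}` and `Dρ ≠ 0` on `∂Ω`. -/
structure IsBoundaryDefining {n : ℕ} (Ω : Set (EucSp n)) (ρ : EucSp n → ℝ) : Prop where
  smooth : ContDiff ℝ ∞ ρ
  eq_pos : Ω = {x | 0 < ρ x}
  grad_ne : ∀ x ∈ frontier Ω, ∇ ρ x ≠ 0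

/-- Bounded, uniformly convex domain with smooth boundary. For a boundary defining function `ρ`, the
second fundamental form of `∂Ω` at `x` (with respect to the inward normal) is
`- D²ρ(x)(ξ, ξ) / |Dρ(x)|` on the tangent vectors `ξ ⊥ Dρ(x)`; uniform convexity says that all
principal curvatures are bounded below by a constant `κ > 0`. -/
structure IsUniformlyConvexDomain {n : ℕ} (Ω : Set (EucSp n)) : Prop where
  isOpen : IsOpen Ω
  nonempty : Ω.Nonempty
  isBounded : Bornology.IsBounded Ω
  convex : Convex ℝ Ω
  curvature : ∃ ρ : EucSp n → ℝ, IsBoundaryDefining Ω ρ ∧ ∃ κ : ℝ, 0 < κ ∧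
    ∀ x ∈ frontier Ω, ∀ ξ : EucSp n, ⟪∇ ρ x, ξ⟫ = 0 →
      iteratedFDeriv ℝ 2 ρ x ![ξ, ξ] ≤ -κ * ‖∇ ρ x‖ * ‖ξ‖ ^ 2

/-- `ν` is the unit inward normal vector of `∂Ω` at `x`. (The normalized gradient at a boundary
point does not depend on the boundary defining function.) -/
def IsInwardUnitNormal {n : ℕ} (Ω : Set (EucSp n)) (x ν : EucSp n) : Prop :=
  ∃ ρ : EucSp n → ℝ, IsBoundaryDefining Ω ρ ∧ ν = ‖∇ ρ x‖⁻¹ • ∇ ρ x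

/-- Defining functions `h` of a uniformly convex domain: smooth, `Ω = {h > 0}`, `|Dh| = 1` on `∂Ω`,
and `D²h ≤ -θ I` in `Ω` for some `θ > 0`. -/
structure IsDefiningFunction {n : ℕ} (Ω : Set (EucSp n)) (h : EucSp n → ℝ) : Prop where
  smooth : ContDiff ℝ ∞ h
  eq_pos : Ω = {p | 0 < h p}
  norm_grad : ∀ p ∈ frontier Ω, ‖∇ h p‖ = 1
  concave : ∃ θ : ℝ, 0 < θ ∧ ∀ p ∈ Ω, ∀ ξ : EucSp n,
    iteratedFDeriv ℝ 2 h p ![ξ, ξ] ≤ -θ * ‖ξ‖ ^ 2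

/-- The spatial gradient `Du` of a function on `closure Ω`, one-sided at boundary points. -/
noncomputable def gradOn {n : ℕ} (Ω : Set (EucSp n)) (f : EucSp n → ℝ) (x : EucSp n) : EucSp n :=
  gradientWithin f (closure Ω) x

/-- The Hessian form `D²f(x)(ξ, η)` of a function on `closure Ω`, one-sided at boundary points. -/
noncomputable def hessOn {n : ℕ} (Ω : Set (EucSp n)) (f : EucSp n → ℝ) (x ξ η : EucSp n) : ℝ :=
  iteratedFDerivWithin ℝ 2 f (closure Ω) x ![ξ, η]

/-- The Hölder class `C^{2+α}(closure Ω)`. -/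
def IsHolderC2 {n : ℕ} (α : ℝ) (Ω : Set (EucSp n)) (f : EucSp n → ℝ) : Prop :=
  ContDiffOn ℝ 2 f (closure Ω) ∧
    ∃ K : ℝ, ∀ x ∈ closure Ω, ∀ y ∈ closure Ω,
      ‖iteratedFDerivWithin ℝ 2 f (closure Ω) x - iteratedFDerivWithin ℝ 2 f (closure Ω) y‖
        ≤ K * ‖x - y‖ ^ α

/-- The derivative `D_x^s D_t^r u` at `(t, x)` of a function of `t ∈ I` and `x ∈ S`. -/
noncomputable def parDeriv {n : ℕ} (I : Set ℝ) (S : Set (EucSp n)) (u : ℝ → EucSp n → ℝ)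
    (r s : ℕ) (t : ℝ) (x : EucSp n) : EucSp n [×s]→L[ℝ] ℝ :=
  iteratedFDerivWithin ℝ s (fun y => iteratedDerivWithin r (fun τ => u τ y) I t) S x

/-- The parabolic Hölder class `C^{2m+α, m+α/2}` on `I × S`: all derivatives `D_x^s D_t^r u` with
`2r + s ≤ 2m` exist and are continuous on `I × S`; on compact subsets of `I × S`, those with
`2r + s = 2m` are `α`-Hölder in `x` and `α/2`-Hölder in `t`, and those with `2r + s = 2m - 1` are
`(1+α)/2`-Hölder in `t`. If `I × S` is compact, the Hölder bounds hold on all of `I × S`; if it is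
open, this is the usual local class. -/
structure IsParabolicHolder {n : ℕ} (m : ℕ) (α : ℝ) (I : Set ℝ) (S : Set (EucSp n))
    (u : ℝ → EucSp n → ℝ) : Prop where
  time : ∀ x ∈ S, ContDiffOn ℝ m (fun τ => u τ x) I
  space : ∀ r : ℕ, r ≤ m → ∀ t ∈ I,
    ContDiffOn ℝ (2 * (m - r) : ℕ) (fun y => iteratedDerivWithin r (fun τ => u τ y) I t) S
  continuous : ∀ r s : ℕ, 2 * r + s ≤ 2 * m →
    ContinuousOn (fun q : ℝ × EucSp n => parDeriv I S u r s q.1 q.2) (I ×ˢ S)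
  holder_top : ∀ Q : Set (ℝ × EucSp n), IsCompact Q → Q ⊆ I ×ˢ S →
    ∀ r s : ℕ, 2 * r + s = 2 * m → ∃ K : ℝ, ∀ q ∈ Q, ∀ q' ∈ Q,
      ‖parDeriv I S u r s q.1 q.2 - parDeriv I S u r s q'.1 q'.2‖
        ≤ K * (‖q.2 - q'.2‖ ^ α + |q.1 - q'.1| ^ (α / 2))
  holder_time : ∀ Q : Set (ℝ × EucSp n), IsCompact Q → Q ⊆ I ×ˢ S →
    ∀ r s : ℕ, 2 * r + s + 1 = 2 * m → ∃ K : ℝ, ∀ q ∈ Q, ∀ q' ∈ Q, q.2 = q'.2 →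
      ‖parDeriv I S u r s q.1 q.2 - parDeriv I S u r s q'.1 q'.2‖
        ≤ K * |q.1 - q'.1| ^ ((1 + α) / 2)

/-- The divergence `∑ᵢ ∂ᵢ Vⁱ` of a vector field. -/
noncomputable def divergence {n : ℕ} (V : EucSp n → EucSp n) (x : EucSp n) : ℝ :=
  LinearMap.trace ℝ (EucSp n) (fderiv ℝ V x : EucSp n →ₗ[ℝ] EucSp n)

/-- `u` (written `u t x`) is a strictly convex solution on `closure Ω × [0, T]`, in the class
`C^{2+α, 1+α/2}(closure Ω × [0, T]) ∩ C^{4+α, 2+α/2}(Ω × (0, T))` for some `α ∈ (0, 1)`, of the graphical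
mean curvature flow in Minkowski space with second boundary condition `Du(Ω) = Ω'` and initial
value `u₀`. -/
structure IsStrictlyConvexSolution {n : ℕ} (Ω Ω' : Set (EucSp n)) (u₀ : EucSp n → ℝ) (T : ℝ)
    (u : ℝ → EucSp n → ℝ) : Prop where
  regular : ∃ α : ℝ, 0 < α ∧ α < 1 ∧ IsParabolicHolder 1 α (Icc 0 T) (closure Ω) u ∧
    IsParabolicHolder 2 α (Ioo 0 T) Ω u
  strictly_convex : ∀ t ∈ Icc 0 T, ∀ x ∈ closure Ω, ∀ ξ : EucSp n, ξ ≠ 0 →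
    0 < hessOn Ω (u t) x ξ ξ
  flow : ∀ t ∈ Ioo 0 T, ∀ x ∈ Ω,
    deriv (fun τ => u τ x) t = √(1 - ‖gradOn Ω (u t) x‖ ^ 2) *
      divergence (fun y => (√(1 - ‖gradOn Ω (u t) y‖ ^ 2))⁻¹ • gradOn Ω (u t) y) x
  second_boundary : ∀ t ∈ Ioc 0 T, gradOn Ω (u t) '' Ω = Ω'
  initial : ∀ x ∈ Ω, u 0 x = u₀ x

/-!
The key quantity is `H = h(Du)`, which vanishes on `∂Ω` and is positive in `Ω`. Its gradient is
`D²u β` with `β = Dh(Du)`, and on `∂Ω` it equals `λ ν` for some `λ > 0`. If `D²u` has trace at most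
`M`, then `λ² = |D²u β|² ≤ M ⟪D²u β, β⟫ = M λ ⟪β, ν⟫`, so `⟪β, ν⟫ ≥ λ / M` and it suffices to bound
the trace of `D²u` from above and the inner normal derivative `λ` of `H` from below.

*Trace bounds.* In nondivergence form the flow is `u_t = Δu + D²u(Du, Du) / (1 - |Du|²)`, so for
convex `u` the trace of `D²u` is comparable to `u_t`. The function `u_t` satisfies a linear parabolic
equation with an oblique boundary condition, hence stays between its initial extremes. It need not
be differentiable up to the boundary, so the maximum principle is applied to the difference quotients
`u(t + τ) - u(t)` instead (`ConvexFlow.sub_le`, `ConvexFlow.time_deriv_le`): both gradients lie on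
`∂Ω'` over `∂Ω`, and convexity of `Ω'` gives the sign of the derivative of the difference in the
direction `β`, which points inward because `D²u > 0`.

*Normal derivative.* Differentiating the flow, `H` satisfies a linear parabolic equation with a
source `-D²h(D²u ·, D²u ·)`, which is bounded below by a positive constant because `h` is uniformly
concave and the trace of `D²u` is bounded below. All coefficients being controlled, `δρ` is a
subsolution for any defining function `ρ` of `Ω` once `δ` is small, whence `H ≥ δρ`
(`ConvexFlow.mul_le_comp_gradient`; the initial inequality is `ConvexFlow.exists_mul_le`) and
`λ ≥ δ |Dρ|`.

The constant is uniform in `h` and in the choice of `ρ` because the unit inward normal of a domain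
does not depend on the defining function (`IsBoundaryDefining.normal_unique`).
-/

open Filter Topology

/-! ### Calculus in Euclidean space -/

/-- The Riesz isomorphism from linear forms to vectors, as a continuous linear map over `ℝ` (Mathlib
has it as a conjugate-linear isometry), so that it can be composed with derivatives. -/
noncomputable def rieszCLM (n : ℕ) : StrongDual ℝ (EucSp n) →L[ℝ] EucSp n :=
  LinearMap.toContinuousLinearMap
    { toFun := (InnerProductSpace.toDual ℝ (EucSp n)).symm
      map_add' := fun a b => map_add _ a b
      map_smul' := fun c a => by simp }

lemma inner_rieszCLM {n : ℕ} (l : StrongDual ℝ (EucSp n)) (v : EucSp n) :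
    ⟪rieszCLM n l, v⟫ = l v :=
  InnerProductSpace.toDual_symm_apply

lemma gradientWithin_eq_rieszCLM {n : ℕ} (f : EucSp n → ℝ) (s : Set (EucSp n)) (x : EucSp n) :
    gradientWithin f s x = rieszCLM n (fderivWithin ℝ f s x) := rfl

lemma hasFDerivWithinAt_of_gradientWithin {n : ℕ} {f : EucSp n → ℝ} {s : Set (EucSp n)}
    {x : EucSp n} (hf : DifferentiableWithinAt ℝ f s x) :
    HasFDerivWithinAt f (innerSL ℝ (gradientWithin f s x)) s x := by
  have e : innerSL ℝ (gradientWithin f s x) = fderivWithin ℝ f s x :=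
    ContinuousLinearMap.ext fun v => inner_rieszCLM _ v
  rw [e]
  exact hf.hasFDerivWithinAt

lemma hasFDerivWithinAt_gradientWithin {n : ℕ} {f : EucSp n → ℝ} {s : Set (EucSp n)}
    (hs : UniqueDiffOn ℝ s) (hf : ContDiffOn ℝ 2 f s) {x : EucSp n} (hx : x ∈ s) :
    HasFDerivWithinAt (gradientWithin f s)
      ((rieszCLM n).comp (fderivWithin ℝ (fderivWithin ℝ f s) s x)) s x := by
  have h1 : DifferentiableWithinAt ℝ (fderivWithin ℝ f s) s x :=
    (hf.fderivWithin hs (m := 1) (by norm_num)).differentiableOn (by norm_num) x hx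
  exact (rieszCLM n).hasFDerivAt.comp_hasFDerivWithinAt x h1.hasFDerivWithinAt

lemma inner_rieszCLM_fderivWithin {n : ℕ} {f : EucSp n → ℝ} {s : Set (EucSp n)}
    (hs : UniqueDiffOn ℝ s) {x : EucSp n} (hx : x ∈ s) (ξ η : EucSp n) :
    ⟪(rieszCLM n).comp (fderivWithin ℝ (fderivWithin ℝ f s) s x) ξ, η⟫
      = iteratedFDerivWithin ℝ 2 f s x ![ξ, η] := by
  rw [iteratedFDerivWithin_two_apply f hs hx]
  simp [inner_rieszCLM]

lemma hasFDerivAt_gradient {n : ℕ} {f : EucSp n → ℝ} (hf : ContDiff ℝ ∞ f) (x : EucSp n) :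
    HasFDerivAt f (innerSL ℝ (∇ f x)) x := by
  have := hasFDerivWithinAt_of_gradientWithin (s := univ)
    (hf.differentiable (by simp) x).differentiableWithinAt
  rwa [gradientWithin_univ, hasFDerivWithinAt_univ] at this

/-- The Hessian of a smooth function as the derivative of its gradient field. -/
noncomputable def hessMap {n : ℕ} (f : EucSp n → ℝ) (x : EucSp n) : EucSp n →L[ℝ] EucSp n :=
  fderiv ℝ (∇ f) x

lemma contDiff_gradient {n : ℕ} {f : EucSp n → ℝ} (hf : ContDiff ℝ ∞ f) : ContDiff ℝ ∞ (∇ f) := by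
  have : ∇ f = fun x => rieszCLM n (fderiv ℝ f x) := rfl
  rw [this]
  exact (rieszCLM n).contDiff.comp (hf.fderiv_right (by simp))

lemma hasFDerivAt_hessMap {n : ℕ} {f : EucSp n → ℝ} (hf : ContDiff ℝ ∞ f) (x : EucSp n) :
    HasFDerivAt (∇ f) (hessMap f x) x :=
  ((contDiff_gradient hf).differentiable (by simp) x).hasFDerivAt

lemma continuous_hessMap {n : ℕ} {f : EucSp n → ℝ} (hf : ContDiff ℝ ∞ f) :
    Continuous (hessMap f) :=
  (contDiff_gradient hf).continuous_fderiv (by simp)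

lemma inner_hessMap {n : ℕ} {f : EucSp n → ℝ} (hf : ContDiff ℝ ∞ f) (x ξ η : EucSp n) :
    ⟪hessMap f x ξ, η⟫ = iteratedFDeriv ℝ 2 f x ![ξ, η] := by
  have h1 := hasFDerivWithinAt_gradientWithin (f := f) (s := univ) uniqueDiffOn_univ
    (contDiff_infty.1 hf 2).contDiffOn (mem_univ x)
  have h2 := inner_rieszCLM_fderivWithin (f := f) (s := univ) uniqueDiffOn_univ (mem_univ x) ξ η
  rw [gradientWithin_univ, hasFDerivWithinAt_univ] at h1
  rw [iteratedFDerivWithin_univ] at h2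
  rw [← h2, h1.unique (hasFDerivAt_hessMap hf x)]

/-- Necessary conditions at an interior local maximum, for a function with gradient field `g`. -/
lemma IsLocalMax.gradient_eq_zero_and_hessian_nonpos {n : ℕ} {f : EucSp n → ℝ}
    {g : EucSp n → EucSp n} {Q : EucSp n →L[ℝ] EucSp n} {x : EucSp n} (hmax : IsLocalMax f x)
    (h1 : ∀ᶠ y in 𝓝 x, HasFDerivAt f (innerSL ℝ (g y)) y) (h2 : HasFDerivAt g Q x) :
    g x = 0 ∧ ∀ v, ⟪Q v, v⟫ ≤ 0 := by
  have hg : g x = 0 := by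
    have := hmax.hasFDerivAt_eq_zero h1.self_of_nhds
    have h3 := congrArg (fun l => l (g x)) this
    simpa using h3
  refine ⟨hg, fun v => ?_⟩
  by_contra! hpos
  have hline : ∀ s : ℝ, HasDerivAt (fun s : ℝ => x + s • v) v s := fun s => by
    simpa using ((hasDerivAt_id s).smul_const v).const_add x
  have hlim : Tendsto (fun s : ℝ => x + s • v) (𝓝 0) (𝓝 x) := by
    simpa using (hline 0).continuousAt.tendsto
  have hφ : ∀ᶠ s : ℝ in 𝓝 0, HasDerivAt (fun s : ℝ => f (x + s • v)) ⟪g (x + s • v), v⟫ s := by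
    filter_upwards [hlim.eventually h1] with s hs
    have h3 := hs.comp_hasDerivAt s (hline s)
    rw [innerSL_apply_apply] at h3
    exact h3
  have hφ' : HasDerivAt (fun s : ℝ => ⟪g (x + s • v), v⟫) ⟪Q v, v⟫ 0 := by
    have h3 : HasDerivAt (fun s : ℝ => g (x + s • v)) (Q v) 0 :=
      HasFDerivAt.comp_hasDerivAt (0 : ℝ) (f := fun s : ℝ => x + s • v) (by simpa using h2)
        (hline 0)
    simpa using h3.inner ℝ (hasDerivAt_const (0 : ℝ) v)
  -- the derivative along the line is positive just after `x`, so `f` increases there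
  have hsl : ∀ᶠ s : ℝ in 𝓝[>] 0, 0 < ⟪g (x + s • v), v⟫ := by
    have h4 := (hasDerivAt_iff_tendsto_slope.1 hφ').eventually (lt_mem_nhds hpos)
    have h5 : ∀ᶠ s : ℝ in 𝓝[>] 0, 0 < slope (fun s : ℝ => ⟪g (x + s • v), v⟫) 0 s :=
      h4.filter_mono (nhdsWithin_mono _ fun s hs => ne_of_gt hs)
    filter_upwards [h5, self_mem_nhdsWithin] with s hs (hs0 : 0 < s)
    simp only [slope_def_field, zero_smul, add_zero, hg, inner_zero_left, sub_zero] at hs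
    exact (div_pos_iff_of_pos_right hs0).1 hs
  have hall : ∀ᶠ s : ℝ in 𝓝[>] 0, HasDerivAt (fun s : ℝ => f (x + s • v)) ⟪g (x + s • v), v⟫ s ∧
      0 < ⟪g (x + s • v), v⟫ ∧ f (x + s • v) ≤ f x :=
    (hφ.filter_mono nhdsWithin_le_nhds).and
      (hsl.and ((hlim.eventually hmax).filter_mono nhdsWithin_le_nhds))
  obtain ⟨ε, hε, hI⟩ := mem_nhdsGT_iff_exists_Ioc_subset.1 hall
  have hε : 0 < ε := hε
  have hcont : ContinuousOn (fun s : ℝ => f (x + s • v)) (Icc 0 ε) := by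
    intro s hs
    rcases hs.1.eq_or_lt with h | h
    · rw [← h]; exact hφ.self_of_nhds.continuousAt.continuousWithinAt
    · exact (hI ⟨h, hs.2⟩).1.continuousAt.continuousWithinAt
  have hmono := strictMonoOn_of_deriv_pos (convex_Icc 0 ε) hcont fun s hs => by
    rw [interior_Icc] at hs
    have := hI ⟨hs.1, hs.2.le⟩
    rw [this.1.deriv]; exact this.2.1
  have h6 := hmono (left_mem_Icc.2 hε.le) (right_mem_Icc.2 hε.le) hε
  have h7 := (hI ⟨hε, le_rfl⟩).2.2
  simp only [zero_smul, add_zero] at h6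
  linarith

lemma HasDerivWithinAt.nonneg_of_max_of_lt {f : ℝ → ℝ} {f' T t : ℝ}
    (hf : HasDerivWithinAt f f' (Icc 0 T) t) (ht : t ∈ Icc 0 T) (h0 : 0 < t)
    (hmax : ∀ s ∈ Icc 0 T, f s ≤ f t) : 0 ≤ f' := by
  have hmem : (0 : ℝ) - t ∈ posTangentConeAt (Icc 0 T) t :=
    sub_mem_posTangentConeAt_of_segment_subset
      ((convex_Icc 0 T).segment_subset ht (left_mem_Icc.2 (h0.le.trans ht.2)))
  have hl : IsLocalMaxOn f (Icc 0 T) t :=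
    eventually_of_mem self_mem_nhdsWithin hmax
  have := hl.hasFDerivWithinAt_nonpos hf.hasFDerivWithinAt hmem
  simp at this
  nlinarith

/-- If `0 ≤ ⟪g, v⟫` on the open half-space `0 < ⟪ν, v⟫`, then `g` is a nonnegative multiple of
`ν`. -/
lemma exists_smul_eq_of_halfSpace {n : ℕ} {g ν : EucSp n} (hν : ν ≠ 0)
    (h : ∀ v, 0 < ⟪ν, v⟫ → 0 ≤ ⟪g, v⟫) : ∃ c : ℝ, 0 ≤ c ∧ g = c • ν := by
  rcases eq_or_ne g 0 with rfl | hg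
  · exact ⟨0, le_rfl, by simp⟩
  have hν' : 0 < ‖ν‖ := norm_pos_iff.2 hν
  have hg' : 0 < ‖g‖ := norm_pos_iff.2 hg
  by_cases hlt : ⟪ν, g⟫ < ‖ν‖ * ‖g‖
  · exfalso
    -- the difference of the two unit vectors separates the half-spaces
    have h1 := h (‖ν‖⁻¹ • ν - ‖g‖⁻¹ • g) (by
      rw [inner_sub_right, real_inner_smul_right, real_inner_smul_right, real_inner_self_eq_norm_sq]
      have : ‖g‖⁻¹ * ⟪ν, g⟫ < ‖g‖⁻¹ * (‖ν‖ * ‖g‖) := by gcongr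
      have e1 : ‖g‖⁻¹ * (‖ν‖ * ‖g‖) = ‖ν‖ := by field_simp
      have e2 : ‖ν‖⁻¹ * ‖ν‖ ^ 2 = ‖ν‖ := by field_simp
      linarith)
    rw [inner_sub_right, real_inner_smul_right, real_inner_smul_right, real_inner_self_eq_norm_sq,
      real_inner_comm] at h1
    have : ‖ν‖⁻¹ * ⟪ν, g⟫ < ‖ν‖⁻¹ * (‖ν‖ * ‖g‖) := by gcongr
    have e1 : ‖ν‖⁻¹ * (‖ν‖ * ‖g‖) = ‖g‖ := by field_simp
    have e2 : ‖g‖⁻¹ * ‖g‖ ^ 2 = ‖g‖ := by field_simp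
    linarith
  · have heq : ⟪ν, g⟫ = ‖ν‖ * ‖g‖ := le_antisymm (real_inner_le_norm ν g) (not_lt.1 hlt)
    rw [inner_eq_norm_mul_iff_real] at heq
    refine ⟨‖g‖ / ‖ν‖, by positivity, ?_⟩
    rw [div_eq_inv_mul, mul_smul, heq, smul_smul, inv_mul_cancel₀ hν'.ne', one_smul]

/-! ### Boundary defining functions and normals -/

namespace IsBoundaryDefining

variable {n : ℕ} {Ω : Set (EucSp n)} {ρ ρ' : EucSp n → ℝ}

lemma nonneg (hρ : IsBoundaryDefining Ω ρ) {x : EucSp n} (hx : x ∈ closure Ω) : 0 ≤ ρ x := by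
  refine closure_minimal (fun y hy => ?_) (isClosed_le continuous_const hρ.smooth.continuous) hx
  rw [hρ.eq_pos] at hy
  exact le_of_lt (show 0 < ρ y from hy)

lemma eq_zero (hρ : IsBoundaryDefining Ω ρ) {x : EucSp n} (hx : x ∈ frontier Ω) : ρ x = 0 := by
  have hopen : IsOpen Ω := by
    rw [hρ.eq_pos]; exact isOpen_lt continuous_const hρ.smooth.continuous
  refine le_antisymm ?_ (hρ.nonneg hx.1)
  by_contra! h
  rw [hopen.frontier_eq] at hx
  exact hx.2 (by rw [hρ.eq_pos]; exact h)

lemma eventually_mem (hρ : IsBoundaryDefining Ω ρ) {x v : EucSp n} (hx : x ∈ frontier Ω)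
    (hv : 0 < ⟪∇ ρ x, v⟫) : ∀ᶠ s : ℝ in 𝓝[>] 0, x + s • v ∈ Ω := by
  have hline : HasDerivAt (fun s : ℝ => x + s • v) v 0 := by
    simpa using ((hasDerivAt_id (0 : ℝ)).smul_const v).const_add x
  have hd := HasFDerivAt.comp_hasDerivAt (0 : ℝ) (f := fun s : ℝ => x + s • v)
    (by simpa using hasFDerivAt_gradient hρ.smooth x) hline
  rw [innerSL_apply_apply] at hd
  have h5 : ∀ᶠ s : ℝ in 𝓝[>] 0, 0 < slope (ρ ∘ fun s : ℝ => x + s • v) 0 s :=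
    ((hasDerivAt_iff_tendsto_slope.1 hd).eventually (lt_mem_nhds hv)).filter_mono
      (nhdsWithin_mono _ fun s hs => ne_of_gt hs)
  filter_upwards [h5, self_mem_nhdsWithin] with s hs (hs0 : 0 < s)
  simp only [slope_def_field, Function.comp_apply, zero_smul, add_zero, hρ.eq_zero hx,
    sub_zero] at hs
  rw [hρ.eq_pos]
  exact (div_pos_iff_of_pos_right hs0).1 hs

lemma mem_posTangentConeAt (hρ : IsBoundaryDefining Ω ρ) {x v : EucSp n} (hx : x ∈ frontier Ω)
    (hv : 0 < ⟪∇ ρ x, v⟫) : v ∈ posTangentConeAt (closure Ω) x :=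
  mem_posTangentConeAt_of_frequently_mem
    (((hρ.eventually_mem hx hv).mono fun _ hs => subset_closure hs).frequently)

/-- Lagrange multiplier rule: at a boundary point where a function on `closure Ω` attains its
minimum, its gradient is a nonnegative multiple of the inward normal. -/
lemma gradient_of_min (hρ : IsBoundaryDefining Ω ρ) {x g : EucSp n} {f : EucSp n → ℝ}
    (hx : x ∈ frontier Ω) (hf : HasFDerivWithinAt f (innerSL ℝ g) (closure Ω) x)
    (hmin : ∀ y ∈ closure Ω, f x ≤ f y) : ∃ c : ℝ, 0 ≤ c ∧ g = c • ∇ ρ x := by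
  refine exists_smul_eq_of_halfSpace (hρ.grad_ne x hx) fun v hv => ?_
  have hl : IsLocalMinOn f (closure Ω) x := eventually_of_mem self_mem_nhdsWithin hmin
  simpa using hl.hasFDerivWithinAt_nonneg hf (hρ.mem_posTangentConeAt hx hv)

/-- The unit inward normal does not depend on the boundary defining function. -/
lemma normal_unique (hρ : IsBoundaryDefining Ω ρ) (hρ' : IsBoundaryDefining Ω ρ') {x : EucSp n}
    (hx : x ∈ frontier Ω) : ‖∇ ρ' x‖⁻¹ • ∇ ρ' x = ‖∇ ρ x‖⁻¹ • ∇ ρ x := by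
  obtain ⟨c, hc, h⟩ := hρ.gradient_of_min hx
    (hasFDerivAt_gradient hρ'.smooth x).hasFDerivWithinAt
    (fun y hy => by rw [hρ'.eq_zero hx]; exact hρ'.nonneg hy)
  have h1 := hρ'.grad_ne x hx
  have hc' : 0 < c := hc.lt_of_ne fun h0 => h1 (by rw [h, ← h0, zero_smul])
  have h2 : ‖∇ ρ x‖ ≠ 0 := norm_ne_zero_iff.2 (hρ.grad_ne x hx)
  rw [h, norm_smul, Real.norm_of_nonneg hc, smul_smul]
  congr 1
  field_simp

end IsBoundaryDefining

lemma IsDefiningFunction.isBoundaryDefining {n : ℕ} {Ω : Set (EucSp n)} {h : EucSp n → ℝ}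
    (hh : IsDefiningFunction Ω h) : IsBoundaryDefining Ω h :=
  ⟨hh.smooth, hh.eq_pos, fun x hx h0 => by simpa [h0] using hh.norm_grad x hx⟩

lemma IsUniformlyConvexDomain.uniqueDiffOn {n : ℕ} {Ω : Set (EucSp n)}
    (hΩ : IsUniformlyConvexDomain Ω) : UniqueDiffOn ℝ (closure Ω) :=
  uniqueDiffOn_convex hΩ.convex.closure
    (hΩ.nonempty.mono (interior_maximal subset_closure hΩ.isOpen))

lemma IsUniformlyConvexDomain.isCompact {n : ℕ} {Ω : Set (EucSp n)}
    (hΩ : IsUniformlyConvexDomain Ω) : IsCompact (closure Ω) :=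
  hΩ.isBounded.isCompact_closure

/-- At boundary points `p, q` of a convex set, the inward normal at `p` makes a nonnegative product
with `q - p`. -/
lemma IsBoundaryDefining.inner_sub_nonneg {n : ℕ} {Ω : Set (EucSp n)} {h : EucSp n → ℝ}
    (hh : IsBoundaryDefining Ω h) (hc : Convex ℝ Ω) {p q : EucSp n} (hp : p ∈ frontier Ω)
    (hq : q ∈ closure Ω) : 0 ≤ ⟪∇ h p, q - p⟫ := by
  have hmem := sub_mem_posTangentConeAt_of_segment_subset
    (hc.closure.segment_subset hp.1 hq)
  have hl : IsLocalMinOn h (closure Ω) p := eventually_of_mem self_mem_nhdsWithin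
    fun y hy => show h p ≤ h y by rw [hh.eq_zero hp]; exact hh.nonneg hy
  simpa using hl.hasFDerivWithinAt_nonneg (hasFDerivAt_gradient hh.smooth p).hasFDerivWithinAt hmem

/-! ### The elliptic operator of the flow -/

/-- The trace of a linear map, written out in the standard orthonormal basis. -/
noncomputable def frameTrace {n : ℕ} (Q : EucSp n →L[ℝ] EucSp n) : ℝ :=
  ∑ i, ⟪Q (EuclideanSpace.basisFun (Fin n) ℝ i), EuclideanSpace.basisFun (Fin n) ℝ i⟫

/-- The operator `Δu + D²u(Du, Du) / (1 - |Du|²)` on the right-hand side of the flow in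
nondivergence form, as a function of `p = Du` and `Q = D²u`. -/
noncomputable def minkOp {n : ℕ} (p : EucSp n) (Q : EucSp n →L[ℝ] EucSp n) : ℝ :=
  frameTrace Q + ⟪Q p, p⟫ / (1 - ‖p‖ ^ 2)

section minkOp

variable {n : ℕ} {p q : EucSp n} {Q Q' : EucSp n →L[ℝ] EucSp n} {r : ℝ}

lemma minkOp_add (p : EucSp n) (Q Q' : EucSp n →L[ℝ] EucSp n) :
    minkOp p (Q + Q') = minkOp p Q + minkOp p Q' := by
  simp only [minkOp, frameTrace, add_apply, inner_add_left, Finset.sum_add_distrib]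
  ring

lemma minkOp_smul (p : EucSp n) (c : ℝ) (Q : EucSp n →L[ℝ] EucSp n) :
    minkOp p (c • Q) = c * minkOp p Q := by
  simp only [minkOp, frameTrace, smul_apply, real_inner_smul_left, ← Finset.mul_sum]
  ring

lemma minkOp_sub (p : EucSp n) (Q Q' : EucSp n →L[ℝ] EucSp n) :
    minkOp p (Q - Q') = minkOp p Q - minkOp p Q' := by
  have := minkOp_add p (Q - Q') Q'
  rw [sub_add_cancel] at this
  linarith

lemma one_sub_sq_pos (hr : r < 1) (hp : ‖p‖ ≤ r) : 0 < 1 - r ^ 2 := by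
  nlinarith [norm_nonneg p]

lemma one_sub_sq_le (hp : ‖p‖ ≤ r) : 1 - r ^ 2 ≤ 1 - ‖p‖ ^ 2 := by
  nlinarith [norm_nonneg p]

lemma minkOp_nonpos (hr : r < 1) (hp : ‖p‖ ≤ r) (hQ : ∀ v, ⟪Q v, v⟫ ≤ 0) : minkOp p Q ≤ 0 := by
  have h1 : 0 < 1 - ‖p‖ ^ 2 := (one_sub_sq_pos hr hp).trans_le (one_sub_sq_le hp)
  exact add_nonpos (Finset.sum_nonpos fun i _ => hQ _)
    (div_nonpos_of_nonpos_of_nonneg (hQ p) h1.le)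

lemma abs_inner_map_le (Q : EucSp n →L[ℝ] EucSp n) (v w : EucSp n) :
    |⟪Q v, w⟫| ≤ ‖Q‖ * ‖v‖ * ‖w‖ :=
  (abs_real_inner_le_norm _ _).trans (by gcongr; exact Q.le_opNorm v)

lemma abs_minkOp_le (hr : r < 1) (hp : ‖p‖ ≤ r) :
    |minkOp p Q| ≤ (n + 1 / (1 - r ^ 2)) * ‖Q‖ := by
  have h0 := one_sub_sq_pos hr hp
  have h1 := one_sub_sq_le hp
  have h2 : |frameTrace Q| ≤ n * ‖Q‖ := by
    refine (Finset.abs_sum_le_sum_abs _ _).trans ?_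
    refine (Finset.sum_le_card_nsmul _ _ ‖Q‖ fun i _ => ?_).trans (by simp)
    simpa using abs_inner_map_le Q (EuclideanSpace.basisFun (Fin n) ℝ i)
      (EuclideanSpace.basisFun (Fin n) ℝ i)
  have h3 : |⟪Q p, p⟫ / (1 - ‖p‖ ^ 2)| ≤ 1 / (1 - r ^ 2) * ‖Q‖ := by
    rw [abs_div, abs_of_pos (h0.trans_le h1), div_mul_eq_mul_div, one_mul]
    have : |⟪Q p, p⟫| ≤ ‖Q‖ := by
      refine (abs_inner_map_le Q p p).trans ?_
      have : ‖p‖ ≤ 1 := hp.trans hr.le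
      calc ‖Q‖ * ‖p‖ * ‖p‖ ≤ ‖Q‖ * 1 * 1 := by gcongr
        _ = ‖Q‖ := by ring
    gcongr
  calc |minkOp p Q| ≤ |frameTrace Q| + |⟪Q p, p⟫ / (1 - ‖p‖ ^ 2)| := abs_add_le _ _
    _ ≤ _ := by rw [add_mul]; gcongr

lemma abs_minkOp_sub_le (hr : r < 1) (hp : ‖p‖ ≤ r) (hq : ‖q‖ ≤ r) :
    |minkOp p Q - minkOp q Q| ≤ 4 / (1 - r ^ 2) ^ 2 * ‖Q‖ * ‖p - q‖ := by
  have h0 := one_sub_sq_pos hr hp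
  have h1 := one_sub_sq_le hp
  have h2 := one_sub_sq_le hq
  have hp1 : ‖p‖ ≤ 1 := hp.trans hr.le
  have hq1 : ‖q‖ ≤ 1 := hq.trans hr.le
  have e : minkOp p Q - minkOp q Q = ((⟪Q (p - q), p⟫ + ⟪Q q, p - q⟫) * (1 - ‖q‖ ^ 2)
      + ⟪Q q, q⟫ * ((‖p‖ - ‖q‖) * (‖p‖ + ‖q‖))) / ((1 - ‖p‖ ^ 2) * (1 - ‖q‖ ^ 2)) := by
    have h3 : 1 - ‖p‖ ^ 2 ≠ 0 := (h0.trans_le h1).ne'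
    have h4 : 1 - ‖q‖ ^ 2 ≠ 0 := (h0.trans_le h2).ne'
    simp only [minkOp, map_sub, inner_sub_left, inner_sub_right]
    field_simp
    ring
  have n1 : |⟪Q (p - q), p⟫ + ⟪Q q, p - q⟫| ≤ 2 * (‖Q‖ * ‖p - q‖) := by
    refine (abs_add_le _ _).trans ?_
    have a := abs_inner_map_le Q (p - q) p
    have b := abs_inner_map_le Q q (p - q)
    have a' : ‖Q‖ * ‖p - q‖ * ‖p‖ ≤ ‖Q‖ * ‖p - q‖ * 1 := by gcongr
    have b' : ‖Q‖ * ‖q‖ * ‖p - q‖ ≤ ‖Q‖ * 1 * ‖p - q‖ := by gcongr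
    linarith
  have n2 : |⟪Q q, q⟫ * ((‖p‖ - ‖q‖) * (‖p‖ + ‖q‖))| ≤ 2 * (‖Q‖ * ‖p - q‖) := by
    rw [abs_mul, abs_mul]
    have a : |⟪Q q, q⟫| ≤ ‖Q‖ := by
      refine (abs_inner_map_le Q q q).trans ?_
      calc ‖Q‖ * ‖q‖ * ‖q‖ ≤ ‖Q‖ * 1 * 1 := by gcongr
        _ = ‖Q‖ := by ring
    have b := abs_norm_sub_norm_le p q
    have c : |‖p‖ + ‖q‖| ≤ 2 := by
      rw [abs_of_nonneg (by positivity)]; linarith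
    calc _ ≤ ‖Q‖ * (‖p - q‖ * 2) := by gcongr
      _ = _ := by ring
  have n3 : |1 - ‖q‖ ^ 2| ≤ 1 := by
    rw [abs_of_pos (h0.trans_le h2)]; nlinarith [norm_nonneg q]
  have n4 : (1 - r ^ 2) ^ 2 ≤ (1 - ‖p‖ ^ 2) * (1 - ‖q‖ ^ 2) := by
    rw [sq]; exact mul_le_mul h1 h2 h0.le (h0.le.trans h1)
  rw [e, abs_div, abs_of_pos (mul_pos (h0.trans_le h1) (h0.trans_le h2))]
  calc _ ≤ (4 * (‖Q‖ * ‖p - q‖)) / ((1 - ‖p‖ ^ 2) * (1 - ‖q‖ ^ 2)) := by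
        gcongr
        · exact (mul_pos (h0.trans_le h1) (h0.trans_le h2)).le
        refine (abs_add_le _ _).trans ?_
        rw [abs_mul]
        have : |⟪Q (p - q), p⟫ + ⟪Q q, p - q⟫| * |1 - ‖q‖ ^ 2| ≤ 2 * (‖Q‖ * ‖p - q‖) * 1 := by
          gcongr
        linarith
    _ ≤ (4 * (‖Q‖ * ‖p - q‖)) / (1 - r ^ 2) ^ 2 := by gcongr
    _ = _ := by ring

/-- For positive semidefinite `Q`, the Cauchy-Schwarz inequality of the form `⟪Q v, w⟫` gives
`|Qv|² ≤ tr Q ⟪Q v, v⟫`. -/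
lemma norm_map_sq_le (hs : ∀ v w, ⟪Q v, w⟫ = ⟪v, Q w⟫) (hQ : ∀ v, 0 ≤ ⟪Q v, v⟫) (v : EucSp n) :
    ‖Q v‖ ^ 2 ≤ frameTrace Q * ⟪Q v, v⟫ := by
  have cs : ∀ w, ⟪Q v, w⟫ ^ 2 ≤ ⟪Q w, w⟫ * ⟪Q v, v⟫ := by
    intro w
    have hd : ∀ x : ℝ, 0 ≤ ⟪Q v, v⟫ * (x * x) + (2 * ⟪Q v, w⟫) * x + ⟪Q w, w⟫ := by
      intro x
      have := hQ (x • v + w)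
      simp only [map_add, map_smul, inner_add_left, inner_add_right, real_inner_smul_left,
        real_inner_smul_right] at this
      have e : ⟪Q w, v⟫ = ⟪Q v, w⟫ := by rw [hs w v, real_inner_comm]
      rw [e] at this
      linarith
    have := discrim_le_zero hd
    rw [discrim] at this
    linarith
  rw [← (EuclideanSpace.basisFun (Fin n) ℝ).sum_sq_inner_left (Q v), frameTrace, Finset.sum_mul]
  refine Finset.sum_le_sum fun i _ => ?_
  exact cs _

lemma norm_map_le (hs : ∀ v w, ⟪Q v, w⟫ = ⟪v, Q w⟫) (hQ : ∀ v, 0 ≤ ⟪Q v, v⟫) (v : EucSp n) :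
    ‖Q v‖ ≤ frameTrace Q * ‖v‖ := by
  have h0 : 0 ≤ frameTrace Q := Finset.sum_nonneg fun i _ => hQ _
  rcases (norm_nonneg (Q v)).eq_or_lt with h | h
  · rw [← h]; positivity
  have h1 := norm_map_sq_le hs hQ v
  have h2 : frameTrace Q * ⟪Q v, v⟫ ≤ frameTrace Q * (‖Q v‖ * ‖v‖) := by
    gcongr; exact real_inner_le_norm _ _
  refine le_of_mul_le_mul_left ?_ h
  nlinarith

lemma frameTrace_le_minkOp (hr : r < 1) (hp : ‖p‖ ≤ r) (hQ : ∀ v, 0 ≤ ⟪Q v, v⟫) :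
    frameTrace Q ≤ minkOp p Q :=
  le_add_of_nonneg_right
    (div_nonneg (hQ p) ((one_sub_sq_pos hr hp).trans_le (one_sub_sq_le hp)).le)

lemma minkOp_mul_le_frameTrace (hr : r < 1) (hp : ‖p‖ ≤ r) (hs : ∀ v w, ⟪Q v, w⟫ = ⟪v, Q w⟫)
    (hQ : ∀ v, 0 ≤ ⟪Q v, v⟫) : minkOp p Q * (1 - r ^ 2) ≤ frameTrace Q := by
  have h0 := one_sub_sq_pos hr hp
  have h1 := one_sub_sq_le hp
  have ht : 0 ≤ frameTrace Q := Finset.sum_nonneg fun i _ => hQ _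
  have h2 : ⟪Q p, p⟫ ≤ frameTrace Q * ‖p‖ ^ 2 := by
    calc ⟪Q p, p⟫ ≤ ‖Q p‖ * ‖p‖ := real_inner_le_norm _ _
      _ ≤ frameTrace Q * ‖p‖ * ‖p‖ := by gcongr; exact norm_map_le hs hQ p
      _ = _ := by ring
  have h3 : minkOp p Q ≤ frameTrace Q / (1 - ‖p‖ ^ 2) := by
    have h4 : 1 - ‖p‖ ^ 2 ≠ 0 := (h0.trans_le h1).ne'
    have : frameTrace Q / (1 - ‖p‖ ^ 2)
        = frameTrace Q + frameTrace Q * ‖p‖ ^ 2 / (1 - ‖p‖ ^ 2) := by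
      field_simp; ring
    rw [this, minkOp]
    have h5 := h0.trans_le h1
    gcongr
  have h4 : frameTrace Q / (1 - ‖p‖ ^ 2) ≤ frameTrace Q / (1 - r ^ 2) := by gcongr
  rw [← le_div_iff₀ h0]
  exact h3.trans h4

lemma frameTrace_sq_le (Q : EucSp n →L[ℝ] EucSp n) : frameTrace Q ^ 2 ≤
    n * ∑ i, ‖Q (EuclideanSpace.basisFun (Fin n) ℝ i)‖ ^ 2 := by
  have h1 := sq_sum_le_card_mul_sum_sq (s := Finset.univ) (f := fun i =>
    ⟪Q (EuclideanSpace.basisFun (Fin n) ℝ i), EuclideanSpace.basisFun (Fin n) ℝ i⟫)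
  rw [Finset.card_univ, Fintype.card_fin] at h1
  refine h1.trans (mul_le_mul_of_nonneg_left (Finset.sum_le_sum fun i _ => ?_) (by positivity))
  rw [sq_le_sq, abs_norm]
  simpa using abs_real_inner_le_norm (Q (EuclideanSpace.basisFun (Fin n) ℝ i))
    (EuclideanSpace.basisFun (Fin n) ℝ i)

lemma continuous_minkOp_comp {X : Type*} [TopologicalSpace X] {s : Set X} {P : X → EucSp n}
    {A : X → EucSp n →L[ℝ] EucSp n} (hP : ContinuousOn P s) (hA : ContinuousOn A s)
    (h1 : ∀ x ∈ s, ‖P x‖ < 1) : ContinuousOn (fun x => minkOp (P x) (A x)) s := by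
  unfold minkOp frameTrace
  refine ContinuousOn.add ?_ (ContinuousOn.div ?_ ?_ ?_)
  · exact continuousOn_finsetSum _ fun i _ => (hA.clm_apply continuousOn_const).inner
      continuousOn_const
  · exact (hA.clm_apply hP).inner hP
  · exact continuousOn_const.sub (hP.norm.pow 2)
  · intro x hx
    have := h1 x hx
    nlinarith [norm_nonneg (P x)]

end minkOp

/-! ### Strictly convex solutions: regularity up to the boundary -/

/-- The properties of a strictly convex solution `U` that hold up to the parabolic boundary:
`P` is the spatial gradient of `U`, `Q` its spatial Hessian and `V` its time derivative, all
continuous on `[0, T] × closure Ω`, and the flow equation holds there in nondivergence form. -/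
structure ConvexFlow {n : ℕ} (Ω Ω' : Set (EucSp n)) (T : ℝ) (U : ℝ → EucSp n → ℝ)
    (P : ℝ → EucSp n → EucSp n) (Q : ℝ → EucSp n → EucSp n →L[ℝ] EucSp n)
    (V : ℝ → EucSp n → ℝ) : Prop where
  space_deriv : ∀ t ∈ Icc 0 T, ∀ x ∈ closure Ω,
    HasFDerivWithinAt (U t) (innerSL ℝ (P t x)) (closure Ω) x
  grad_deriv : ∀ t ∈ Icc 0 T, ∀ x ∈ closure Ω, HasFDerivWithinAt (P t) (Q t x) (closure Ω) x
  symm : ∀ t ∈ Icc 0 T, ∀ x ∈ closure Ω, ∀ v w, ⟪Q t x v, w⟫ = ⟪v, Q t x w⟫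
  pos : ∀ t ∈ Icc 0 T, ∀ x ∈ closure Ω, ∀ v, v ≠ 0 → 0 < ⟪Q t x v, v⟫
  time_deriv : ∀ t ∈ Icc 0 T, ∀ x ∈ closure Ω,
    HasDerivWithinAt (fun s => U s x) (V t x) (Icc 0 T) t
  cont_U : ContinuousOn (fun q : ℝ × EucSp n => U q.1 q.2) (Icc 0 T ×ˢ closure Ω)
  cont_P : ContinuousOn (fun q : ℝ × EucSp n => P q.1 q.2) (Icc 0 T ×ˢ closure Ω)
  cont_Q : ContinuousOn (fun q : ℝ × EucSp n => Q q.1 q.2) (Icc 0 T ×ˢ closure Ω)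
  cont_V : ContinuousOn (fun q : ℝ × EucSp n => V q.1 q.2) (Icc 0 T ×ˢ closure Ω)
  equation : ∀ t ∈ Icc 0 T, ∀ x ∈ closure Ω, V t x = minkOp (P t x) (Q t x)
  image : ∀ t ∈ Icc 0 T, P t '' Ω = Ω'

namespace ConvexFlow

variable {n : ℕ} {Ω Ω' : Set (EucSp n)} {T : ℝ} {U : ℝ → EucSp n → ℝ}
  {P : ℝ → EucSp n → EucSp n} {Q : ℝ → EucSp n → EucSp n →L[ℝ] EucSp n} {V : ℝ → EucSp n → ℝ}

lemma nonneg (F : ConvexFlow Ω Ω' T U P Q V) {t : ℝ} (ht : t ∈ Icc 0 T) {x : EucSp n}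
    (hx : x ∈ closure Ω) (v : EucSp n) : 0 ≤ ⟪Q t x v, v⟫ := by
  rcases eq_or_ne v 0 with rfl | h
  · simp
  · exact (F.pos t ht x hx v h).le

lemma gradient_mem_closure (F : ConvexFlow Ω Ω' T U P Q V) {t : ℝ} (ht : t ∈ Icc 0 T)
    {x : EucSp n} (hx : x ∈ closure Ω) : P t x ∈ closure Ω' := by
  have hc : ContinuousOn (P t) (closure Ω) :=
    fun y hy => (F.grad_deriv t ht y hy).continuousWithinAt
  rw [← F.image t ht]
  exact hc.image_closure (mem_image_of_mem _ hx)

/-- The gradient map of a strictly convex function is strictly monotone. -/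
lemma inner_gradient_sub_pos (F : ConvexFlow Ω Ω' T U P Q V) (hΩ : Convex ℝ Ω) {t : ℝ}
    (ht : t ∈ Icc 0 T) {x y : EucSp n} (hx : x ∈ closure Ω) (hy : y ∈ closure Ω) (hxy : x ≠ y) :
    0 < ⟪P t x - P t y, x - y⟫ := by
  set v := x - y with hv
  have hseg : ∀ s ∈ Icc (0 : ℝ) 1, y + s • v ∈ closure Ω := fun s hs =>
    hΩ.closure.add_smul_sub_mem hy hx hs
  have hline : ∀ s : ℝ, HasDerivAt (fun s : ℝ => y + s • v) v s := fun s => by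
    simpa using ((hasDerivAt_id s).smul_const v).const_add y
  have hd : ∀ s ∈ Icc (0 : ℝ) 1, HasDerivWithinAt (fun s : ℝ => ⟪P t (y + s • v), v⟫)
      ⟪Q t (y + s • v) v, v⟫ (Icc 0 1) s := by
    intro s hs
    have h1 := (F.grad_deriv t ht _ (hseg s hs)).comp_hasDerivWithinAt s
      (hline s).hasDerivWithinAt (fun s hs => hseg s hs)
    simpa using h1.inner ℝ (hasDerivWithinAt_const s (Icc 0 1) v)
  have hmono := strictMonoOn_of_deriv_pos (convex_Icc (0 : ℝ) 1)
    (fun s hs => (hd s hs).continuousWithinAt) fun s hs => by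
      rw [interior_Icc] at hs
      rw [((hd s (Ioo_subset_Icc_self hs)).hasDerivAt (Icc_mem_nhds hs.1 hs.2)).deriv]
      exact F.pos t ht _ (hseg s (Ioo_subset_Icc_self hs)) v (sub_ne_zero.2 hxy)
  have := hmono (left_mem_Icc.2 zero_le_one) (right_mem_Icc.2 zero_le_one) zero_lt_one
  simp only [zero_smul, add_zero, one_smul] at this
  rw [inner_sub_left]
  have e : y + v = x := by rw [hv]; abel
  rw [e] at this
  linarith

/-- The gradient map sends `∂Ω` to `∂Ω'`, because it is injective on `closure Ω` and already maps
`Ω` onto `Ω'`. -/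
lemma gradient_mem_frontier (F : ConvexFlow Ω Ω' T U P Q V) (hΩ : IsUniformlyConvexDomain Ω)
    (hΩ' : IsUniformlyConvexDomain Ω') {t : ℝ} (ht : t ∈ Icc 0 T) {x : EucSp n}
    (hx : x ∈ frontier Ω) : P t x ∈ frontier Ω' := by
  rw [hΩ'.isOpen.frontier_eq]
  refine ⟨F.gradient_mem_closure ht hx.1, fun hmem => ?_⟩
  rw [← F.image t ht] at hmem
  obtain ⟨y, hy, hxy⟩ := hmem
  rw [hΩ.isOpen.frontier_eq] at hx
  have := F.inner_gradient_sub_pos hΩ.convex ht hx.1 (subset_closure hy)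
    (fun h => hx.2 (h ▸ hy))
  rw [hxy, sub_self, inner_zero_left] at this
  exact lt_irrefl _ this

lemma hasFDerivWithinAt_comp_gradient (F : ConvexFlow Ω Ω' T U P Q V) {h : EucSp n → ℝ}
    (hh : ContDiff ℝ ∞ h) {t : ℝ} (ht : t ∈ Icc 0 T) {x : EucSp n} (hx : x ∈ closure Ω) :
    HasFDerivWithinAt (fun y => h (P t y)) (innerSL ℝ (Q t x (∇ h (P t x)))) (closure Ω) x := by
  have h1 := (hasFDerivAt_gradient hh (P t x)).comp_hasFDerivWithinAt x (F.grad_deriv t ht x hx)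
  have e : (innerSL ℝ (∇ h (P t x))).comp (Q t x) = innerSL ℝ (Q t x (∇ h (P t x))) :=
    ContinuousLinearMap.ext fun v => by
      simp [F.symm t ht x hx]
  rw [e] at h1
  exact h1

/-- On `∂Ω` the vector `D²u β`, the gradient of `h(Du)`, is a positive multiple of the inward
normal; hence `β` points strictly inward. -/
lemma oblique_pos (F : ConvexFlow Ω Ω' T U P Q V) (hΩ : IsUniformlyConvexDomain Ω)
    (hΩ' : IsUniformlyConvexDomain Ω') {ρ h : EucSp n → ℝ} (hρ : IsBoundaryDefining Ω ρ)
    (hh : IsBoundaryDefining Ω' h) {t : ℝ} (ht : t ∈ Icc 0 T) {x : EucSp n}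
    (hx : x ∈ frontier Ω) : (∃ c : ℝ, 0 < c ∧ Q t x (∇ h (P t x)) = c • ∇ ρ x) ∧
      0 < ⟪∇ ρ x, ∇ h (P t x)⟫ := by
  have hP := F.gradient_mem_frontier hΩ hΩ' ht hx
  obtain ⟨c, hc, hQ⟩ := hρ.gradient_of_min hx (F.hasFDerivWithinAt_comp_gradient hh.smooth ht hx.1)
    (fun y hy => by rw [hh.eq_zero hP]; exact hh.nonneg (F.gradient_mem_closure ht hy))
  have hpos := F.pos t ht x hx.1 _ (hh.grad_ne _ hP)
  rw [hQ, real_inner_smul_left] at hpos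
  have hc' : 0 < c := hc.lt_of_ne fun h0 => by simp [← h0] at hpos
  exact ⟨⟨c, hc', hQ⟩, (mul_pos_iff_of_pos_left hc').1 hpos⟩

lemma shift (F : ConvexFlow Ω Ω' T U P Q V) {τ : ℝ} (hτ : 0 ≤ τ) :
    ConvexFlow Ω Ω' (T - τ) (fun t => U (t + τ)) (fun t => P (t + τ)) (fun t => Q (t + τ))
      (fun t => V (t + τ)) := by
  have hm : MapsTo (fun t => t + τ) (Icc 0 (T - τ)) (Icc 0 T) := fun t ht =>
    ⟨add_nonneg ht.1 hτ, by linarith [ht.2]⟩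
  have hm2 : MapsTo (fun q : ℝ × EucSp n => (q.1 + τ, q.2)) (Icc 0 (T - τ) ×ˢ closure Ω)
      (Icc 0 T ×ˢ closure Ω) := fun q hq => ⟨hm hq.1, hq.2⟩
  have hc : ContinuousOn (fun q : ℝ × EucSp n => (q.1 + τ, q.2)) (Icc 0 (T - τ) ×ˢ closure Ω) := by
    fun_prop
  exact
    { space_deriv := fun t ht => F.space_deriv _ (hm ht)
      grad_deriv := fun t ht => F.grad_deriv _ (hm ht)
      symm := fun t ht => F.symm _ (hm ht)
      pos := fun t ht => F.pos _ (hm ht)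
      time_deriv := fun t ht x hx => by
        have := (F.time_deriv _ (hm ht) x hx).scomp t
          ((hasDerivAt_id t).add_const τ).hasDerivWithinAt hm
        rw [one_smul] at this
        exact this
      cont_U := F.cont_U.comp hc hm2
      cont_P := F.cont_P.comp hc hm2
      cont_Q := F.cont_Q.comp hc hm2
      cont_V := F.cont_V.comp hc hm2
      equation := fun t ht => F.equation _ (hm ht)
      image := fun t ht => F.image _ (hm ht) }

lemma restrict (F : ConvexFlow Ω Ω' T U P Q V) {S : ℝ} (hS : S ≤ T) :
    ConvexFlow Ω Ω' S U P Q V := by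
  have hm : Icc 0 S ⊆ Icc 0 T := Icc_subset_Icc_right hS
  have hm2 : Icc 0 S ×ˢ closure Ω ⊆ Icc 0 T ×ˢ closure Ω := prod_mono hm subset_rfl
  exact
    { space_deriv := fun t ht => F.space_deriv _ (hm ht)
      grad_deriv := fun t ht => F.grad_deriv _ (hm ht)
      symm := fun t ht => F.symm _ (hm ht)
      pos := fun t ht => F.pos _ (hm ht)
      time_deriv := fun t ht x hx => (F.time_deriv _ (hm ht) x hx).mono hm
      cont_U := F.cont_U.mono hm2
      cont_P := F.cont_P.mono hm2
      cont_Q := F.cont_Q.mono hm2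
      cont_V := F.cont_V.mono hm2
      equation := fun t ht => F.equation _ (hm ht)
      image := fun t ht => F.image _ (hm ht) }

end ConvexFlow

/-! ### Comparison of solutions and bounds for the time derivative -/

/-- Comparison principle for two solutions with the same second boundary condition. At a boundary
maximum of the difference, convexity of `Ω'` gives the sign of the derivative in the oblique
direction `β`, and no a priori bound is needed. -/
lemma ConvexFlow.sub_le {n : ℕ} {Ω Ω' : Set (EucSp n)} {T r M : ℝ}
    {U₁ U₂ : ℝ → EucSp n → ℝ} {P₁ P₂ : ℝ → EucSp n → EucSp n}
    {Q₁ Q₂ : ℝ → EucSp n → EucSp n →L[ℝ] EucSp n} {V₁ V₂ : ℝ → EucSp n → ℝ}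
    (F₁ : ConvexFlow Ω Ω' T U₁ P₁ Q₁ V₁) (F₂ : ConvexFlow Ω Ω' T U₂ P₂ Q₂ V₂)
    (hΩ : IsUniformlyConvexDomain Ω) (hΩ' : IsUniformlyConvexDomain Ω')
    {ρ h : EucSp n → ℝ} (hρ : IsBoundaryDefining Ω ρ) (hh : IsBoundaryDefining Ω' h)
    (hr : r < 1) (hr' : ∀ p ∈ closure Ω', ‖p‖ ≤ r)
    (h0 : ∀ x ∈ closure Ω, U₁ 0 x - U₂ 0 x ≤ M) {t : ℝ} (ht : t ∈ Icc 0 T) {x : EucSp n}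
    (hx : x ∈ closure Ω) : U₁ t x - U₂ t x ≤ M := by
  by_contra! hlt
  have hT : 0 ≤ T := ht.1.trans ht.2
  have hΩc := hΩ.isCompact
  have hcyl : IsCompact (Icc 0 T ×ˢ closure Ω) := isCompact_Icc.prod hΩc
  obtain ⟨R, hR⟩ := hΩc.exists_bound_of_continuousOn hρ.smooth.continuous.continuousOn
  obtain ⟨G, hG⟩ := hΩc.exists_bound_of_continuousOn
    (contDiff_gradient hρ.smooth).continuous.continuousOn
  obtain ⟨W, hW⟩ := hΩc.exists_bound_of_continuousOn (continuous_hessMap hρ.smooth).continuousOn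
  obtain ⟨B, hB⟩ := hcyl.exists_bound_of_continuousOn F₂.cont_Q
  have hG0 : 0 ≤ G := (norm_nonneg _).trans (hG x hx)
  have hW0 : 0 ≤ W := (norm_nonneg _).trans (hW x hx)
  have hB0 : 0 ≤ B := (norm_nonneg _).trans (hB (t, x) ⟨ht, hx⟩)
  have hR0 : 0 ≤ R := (norm_nonneg _).trans (hR x hx)
  have hr2 := one_sub_sq_pos hr (hr' _ (F₁.gradient_mem_closure ht hx))
  set C := (n : ℝ) + 1 / (1 - r ^ 2) with hC
  set L := 4 / (1 - r ^ 2) ^ 2 with hL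
  have hC0 : 0 ≤ C := by positivity
  have hL0 : 0 ≤ L := by positivity
  set K := C * W + L * B * G + 1 with hK
  have hK0 : 0 < K := by positivity
  obtain ⟨ε, hε, hεlt⟩ : ∃ ε : ℝ, 0 < ε ∧ ε * (R + K * T) < U₁ t x - U₂ t x - M := by
    have hd : 0 < U₁ t x - U₂ t x - M := by linarith
    refine ⟨(U₁ t x - U₂ t x - M) / (R + K * T + 1), by positivity, ?_⟩
    rw [div_mul_eq_mul_div, div_lt_iff₀ (by positivity)]
    nlinarith
  have hcont : ContinuousOn (fun q : ℝ × EucSp n =>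
      U₁ q.1 q.2 - U₂ q.1 q.2 + ε * ρ q.2 - ε * K * q.1) (Icc 0 T ×ˢ closure Ω) := by
    refine ((F₁.cont_U.sub F₂.cont_U).add ?_).sub ?_
    · exact (continuous_const.mul (hρ.smooth.continuous.comp continuous_snd)).continuousOn
    · exact (continuous_const.mul continuous_fst).continuousOn
  obtain ⟨⟨t₀, x₀⟩, ⟨ht₀, hx₀⟩, hmax⟩ := hcyl.exists_isMaxOn ⟨(t, x), ht, hx⟩ hcont
  have ht₀ : t₀ ∈ Icc 0 T := ht₀
  have hx₀ : x₀ ∈ closure Ω := hx₀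
  have hmax : ∀ s ∈ Icc 0 T, ∀ y ∈ closure Ω, U₁ s y - U₂ s y + ε * ρ y - ε * K * s ≤
      U₁ t₀ x₀ - U₂ t₀ x₀ + ε * ρ x₀ - ε * K * t₀ := fun s hs y hy =>
    isMaxOn_iff.1 hmax (s, y) ⟨hs, hy⟩
  have htpos : 0 < t₀ := by
    refine ht₀.1.lt_of_ne fun h => ?_
    have h1 := hmax t ht x hx
    have h2 := h0 x₀ hx₀
    have h3 := (le_abs_self _).trans (hR x₀ hx₀)
    have h4 := hρ.nonneg hx
    rw [← h] at h1
    have h5 : ε * ρ x₀ ≤ ε * R := by gcongr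
    have h6 : ε * K * t ≤ ε * K * T := by gcongr; exact ht.2
    have h7 : 0 ≤ ε * ρ x := by positivity
    linarith
  have hgrad : ∀ y ∈ closure Ω, HasFDerivWithinAt
      (fun y => U₁ t₀ y - U₂ t₀ y + ε * ρ y - ε * K * t₀)
      (innerSL ℝ (P₁ t₀ y - P₂ t₀ y + ε • ∇ ρ y)) (closure Ω) y := by
    intro y hy
    have h1 := ((F₁.space_deriv t₀ ht₀ y hy).sub (F₂.space_deriv t₀ ht₀ y hy)).add
      ((hasFDerivAt_gradient hρ.smooth y).hasFDerivWithinAt.const_mul ε)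
    simp only [map_add, map_sub, map_smul]
    exact h1.sub_const (ε * K * t₀)
  by_cases hin : x₀ ∈ Ω
  · have hnhds : closure Ω ∈ 𝓝 x₀ := mem_of_superset (hΩ.isOpen.mem_nhds hin) subset_closure
    have hloc : IsLocalMax (fun y => U₁ t₀ y - U₂ t₀ y + ε * ρ y - ε * K * t₀) x₀ := by
      filter_upwards [hnhds] with y hy using hmax t₀ ht₀ y hy
    obtain ⟨hg, hq⟩ := hloc.gradient_eq_zero_and_hessian_nonpos
      (g := fun y => P₁ t₀ y - P₂ t₀ y + ε • ∇ ρ y)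
      (Q := Q₁ t₀ x₀ - Q₂ t₀ x₀ + ε • hessMap ρ x₀)
      (by
        filter_upwards [hΩ.isOpen.mem_nhds hin] with y hy
        exact (hgrad y (subset_closure hy)).hasFDerivAt
          (mem_of_superset (hΩ.isOpen.mem_nhds hy) subset_closure))
      ((((F₁.grad_deriv t₀ ht₀ x₀ hx₀).hasFDerivAt hnhds).sub
        ((F₂.grad_deriv t₀ ht₀ x₀ hx₀).hasFDerivAt hnhds)).add
        ((hasFDerivAt_hessMap hρ.smooth x₀).const_smul ε))
    have htime : HasDerivWithinAt (fun s => U₁ s x₀ - U₂ s x₀ + ε * ρ x₀ - ε * K * s)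
        (V₁ t₀ x₀ - V₂ t₀ x₀ - ε * K) (Icc 0 T) t₀ := by
      have h1 := (((F₁.time_deriv t₀ ht₀ x₀ hx₀).sub (F₂.time_deriv t₀ ht₀ x₀ hx₀)).add_const
        (ε * ρ x₀)).sub ((hasDerivWithinAt_id t₀ (Icc 0 T)).const_mul (ε * K))
      rw [mul_one] at h1
      exact h1
    have hV := htime.nonneg_of_max_of_lt ht₀ htpos fun s hs => hmax s hs x₀ hx₀
    have hp₁ := hr' _ (F₁.gradient_mem_closure ht₀ hx₀)
    have hp₂ := hr' _ (F₂.gradient_mem_closure ht₀ hx₀)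
    rw [F₁.equation t₀ ht₀ x₀ hx₀, F₂.equation t₀ ht₀ x₀ hx₀] at hV
    have h1 := minkOp_nonpos hr hp₁ hq
    rw [minkOp_add, minkOp_sub, minkOp_smul] at h1
    have h2 := (neg_le_abs _).trans (abs_minkOp_le (Q := hessMap ρ x₀) hr hp₁)
    have h3 := (le_abs_self _).trans (abs_minkOp_sub_le (Q := Q₂ t₀ x₀) hr hp₁ hp₂)
    have h4 : ‖P₁ t₀ x₀ - P₂ t₀ x₀‖ ≤ ε * G := by
      rw [eq_neg_of_add_eq_zero_left hg, norm_neg, norm_smul, Real.norm_of_nonneg hε.le]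
      gcongr
      exact hG x₀ hx₀
    have h5 : C * ‖hessMap ρ x₀‖ ≤ C * W := by gcongr; exact hW x₀ hx₀
    have h6 : L * ‖Q₂ t₀ x₀‖ * ‖P₁ t₀ x₀ - P₂ t₀ x₀‖ ≤ L * B * (ε * G) := by
      gcongr; exact hB (t₀, x₀) ⟨ht₀, hx₀⟩
    have h7 : ε * -minkOp (P₁ t₀ x₀) (hessMap ρ x₀) ≤ ε * (C * W) := by
      gcongr; exact h2.trans h5
    rw [hK] at hV
    nlinarith
  · have hfr : x₀ ∈ frontier Ω := by
      rw [hΩ.isOpen.frontier_eq]; exact ⟨hx₀, hin⟩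
    have hob := (F₂.oblique_pos hΩ hΩ' hρ hh ht₀ hfr).2
    have hl : IsLocalMaxOn (fun y => U₁ t₀ y - U₂ t₀ y + ε * ρ y - ε * K * t₀) (closure Ω) x₀ :=
      eventually_of_mem self_mem_nhdsWithin fun y hy => hmax t₀ ht₀ y hy
    have h1 := hl.hasFDerivWithinAt_nonpos (hgrad x₀ hx₀) (hρ.mem_posTangentConeAt hfr hob)
    have h2 := hh.inner_sub_nonneg hΩ'.convex (F₂.gradient_mem_frontier hΩ hΩ' ht₀ hfr)
      (F₁.gradient_mem_closure ht₀ hx₀)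
    rw [innerSL_apply_apply, inner_add_left, real_inner_smul_left, real_inner_comm] at h1
    have h3 : 0 < ε * ⟪∇ ρ x₀, ∇ h (P₂ t₀ x₀)⟫ := by positivity
    linarith

lemma le_of_forall_Ico_le {f : ℝ → ℝ} {T M : ℝ} (hT : 0 < T) (hf : ContinuousOn f (Icc 0 T))
    (h : ∀ t ∈ Ico 0 T, f t ≤ M) {t : ℝ} (ht : t ∈ Icc 0 T) : f t ≤ M := by
  have hsub : Icc 0 T ⊆ closure (Ico 0 T) := by rw [closure_Ico hT.ne]
  exact ((hf t ht).mono Ico_subset_Icc_self).closure_le (hsub ht) continuousWithinAt_const h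

/-- Bounds for `u_t` are preserved by the flow. The time derivative need not be differentiable up to
the boundary, so the comparison principle is applied to the difference quotients
`(u(t + τ) - u(t)) / τ`; the sign `c = ±1` covers upper and lower bounds together. -/
lemma ConvexFlow.time_deriv_le {n : ℕ} {Ω Ω' : Set (EucSp n)} {T r M c : ℝ}
    {U : ℝ → EucSp n → ℝ} {P : ℝ → EucSp n → EucSp n}
    {Q : ℝ → EucSp n → EucSp n →L[ℝ] EucSp n} {V : ℝ → EucSp n → ℝ}
    (F : ConvexFlow Ω Ω' T U P Q V)
    (hΩ : IsUniformlyConvexDomain Ω) (hΩ' : IsUniformlyConvexDomain Ω')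
    {ρ h : EucSp n → ℝ} (hρ : IsBoundaryDefining Ω ρ) (hh : IsBoundaryDefining Ω' h)
    (hr : r < 1) (hr' : ∀ p ∈ closure Ω', ‖p‖ ≤ r) (hT : 0 < T) (hc : c = 1 ∨ c = -1)
    (h0 : ∀ x ∈ closure Ω, c * V 0 x ≤ M) {t : ℝ} (ht : t ∈ Icc 0 T) {x : EucSp n}
    (hx : x ∈ closure Ω) : c * V t x ≤ M := by
  have hslice : ContinuousOn (fun s => c * V s x) (Icc 0 T) :=
    continuousOn_const.mul (F.cont_V.comp (f := fun s : ℝ => (s, x))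
      (by fun_prop) fun s hs => ⟨hs, hx⟩)
  refine le_of_forall_Ico_le hT hslice (fun t ht => ?_) ht
  refine le_of_forall_pos_le_add fun η hη => ?_
  have hcyl : IsCompact (Icc 0 T ×ˢ closure Ω) := isCompact_Icc.prod hΩ.isCompact
  obtain ⟨δ, hδ, hV⟩ := Metric.uniformContinuousOn_iff.1
    (hcyl.uniformContinuousOn_of_continuous F.cont_V) η hη
  have hVη : ∀ s ∈ Icc 0 T, s < δ → ∀ y ∈ closure Ω, c * V s y ≤ M + η := by
    intro s hs hsδ y hy
    have h1 := hV (s, y) ⟨hs, hy⟩ (0, y) ⟨left_mem_Icc.2 hT.le, hy⟩ (by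
      rw [Prod.dist_eq, dist_self, Real.dist_eq, sub_zero, abs_of_nonneg hs.1]
      exact max_lt hsδ hδ)
    rw [Real.dist_eq, abs_lt] at h1
    have h2 := h0 y hy
    rcases hc with rfl | rfl <;> linarith [h1.1, h1.2]
  have hquot : ∀ τ, 0 < τ → τ < δ → τ ≤ T - t → c * (U (t + τ) x - U t x) ≤ (M + η) * τ := by
    intro τ hτ hτδ hτT
    have hτ' : τ ≤ T := by linarith [ht.1]
    have hinit : ∀ y ∈ closure Ω, c * (U τ y - U 0 y) ≤ (M + η) * τ := by
      intro y hy
      have hd : ∀ s ∈ Icc 0 τ, HasDerivWithinAt (fun s => c * U s y) (c * V s y) (Icc 0 τ) s :=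
        fun s hs => ((F.time_deriv s ⟨hs.1, hs.2.trans hτ'⟩ y hy).mono
          (Icc_subset_Icc_right hτ')).const_mul c
      have hi : ∀ s ∈ interior (Icc 0 τ), HasDerivAt (fun s => c * U s y) (c * V s y) s := by
        intro s hs
        rw [interior_Icc] at hs
        exact (hd s (Ioo_subset_Icc_self hs)).hasDerivAt (Icc_mem_nhds hs.1 hs.2)
      have h1 := (convex_Icc 0 τ).image_sub_le_mul_sub_of_deriv_le
        (fun s hs => (hd s hs).continuousWithinAt)
        (fun s hs => (hi s hs).differentiableAt.differentiableWithinAt)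
        (C := M + η)
        (fun s hs => by
          rw [(hi s hs).deriv]
          have hs' := interior_subset hs
          exact hVη s ⟨hs'.1, hs'.2.trans hτ'⟩ (hs'.2.trans_lt hτδ) y hy)
        0 (left_mem_Icc.2 hτ.le) τ (right_mem_Icc.2 hτ.le) hτ.le
      linarith
    have F₁ := F.shift hτ.le
    have F₂ := F.restrict (show T - τ ≤ T by linarith)
    have ht' : t ∈ Icc 0 (T - τ) := ⟨ht.1, by linarith⟩
    rcases hc with rfl | rfl
    · have := F₁.sub_le F₂ hΩ hΩ' hρ hh hr hr' (M := (M + η) * τ)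
        (fun y hy => by simpa using hinit y hy) ht' hx
      simpa using this
    · have := F₂.sub_le F₁ hΩ hΩ' hρ hh hr hr' (M := (M + η) * τ)
        (fun y hy => by simpa using hinit y hy) ht' hx
      simpa using this
  have hd : HasDerivWithinAt (fun s => c * U s x) (c * V t x) (Ioi t) t :=
    ((F.time_deriv t ⟨ht.1, ht.2.le⟩ x hx).const_mul c).mono_of_mem_nhdsWithin
      (mem_of_superset (Ioc_mem_nhdsGT ht.2) fun s hs => ⟨ht.1.trans hs.1.le, hs.2⟩)
  rw [hasDerivWithinAt_iff_tendsto_slope' self_notMem_Ioi] at hd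
  refine le_of_tendsto hd ?_
  have hm : 0 < min δ (T - t) := lt_min hδ (sub_pos.2 ht.2)
  filter_upwards [Ioo_mem_nhdsGT (show t < t + min δ (T - t) by linarith)] with s hs
  have hs1 : 0 < s - t := sub_pos.2 hs.1
  have hs2 : s - t < min δ (T - t) := by linarith [hs.2]
  have h1 := hquot (s - t) hs1 (hs2.trans_le (min_le_left _ _))
    (hs2.le.trans (min_le_right _ _))
  rw [add_sub_cancel] at h1
  rw [slope_def_field, div_le_iff₀ hs1]
  linarith

/-! ### The boundary barrier -/

lemma IsBoundaryDefining.eventually_notMem_closure {n : ℕ} {Ω : Set (EucSp n)} {ρ : EucSp n → ℝ}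
    (hρ : IsBoundaryDefining Ω ρ) {x : EucSp n} (hx : x ∈ frontier Ω) :
    ∀ᶠ s : ℝ in 𝓝[>] 0, x - s • ∇ ρ x ∉ closure Ω := by
  have hline : HasDerivAt (fun s : ℝ => x - s • ∇ ρ x) (-∇ ρ x) 0 := by
    simpa using ((hasDerivAt_id (0 : ℝ)).smul_const (∇ ρ x)).const_sub x
  have hd := HasFDerivAt.comp_hasDerivAt (0 : ℝ) (f := fun s : ℝ => x - s • ∇ ρ x)
    (by simpa using hasFDerivAt_gradient hρ.smooth x) hline
  rw [innerSL_apply_apply, inner_neg_right] at hd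
  have hneg : -⟪∇ ρ x, ∇ ρ x⟫ < 0 := neg_neg_of_pos (real_inner_self_pos.2 (hρ.grad_ne x hx))
  have h5 : ∀ᶠ s : ℝ in 𝓝[>] 0, slope (ρ ∘ fun s : ℝ => x - s • ∇ ρ x) 0 s < 0 :=
    ((hasDerivAt_iff_tendsto_slope.1 hd).eventually (gt_mem_nhds hneg)).filter_mono
      (nhdsWithin_mono _ fun s hs => ne_of_gt hs)
  filter_upwards [h5, self_mem_nhdsWithin] with s hs (hs0 : 0 < s) hmem
  simp only [slope_def_field, Function.comp_apply, zero_smul, sub_zero, hρ.eq_zero hx] at hs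
  exact absurd (div_nonneg (hρ.nonneg hmem) hs0.le) (not_le.2 hs)

namespace ConvexFlow

variable {n : ℕ} {Ω Ω' : Set (EucSp n)} {T : ℝ} {U : ℝ → EucSp n → ℝ}
  {P : ℝ → EucSp n → EucSp n} {Q : ℝ → EucSp n → EucSp n →L[ℝ] EucSp n} {V : ℝ → EucSp n → ℝ}

lemma eventually_mul_le_of_frontier (F : ConvexFlow Ω Ω' T U P Q V)
    (hΩ : IsUniformlyConvexDomain Ω)
    (hΩ' : IsUniformlyConvexDomain Ω') {ρ h : EucSp n → ℝ} (hρ : IsBoundaryDefining Ω ρ)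
    (hh : IsBoundaryDefining Ω' h) {t : ℝ} (ht : t ∈ Icc 0 T) {x : EucSp n}
    (hx : x ∈ frontier Ω) :
    ∃ δ : ℝ, 0 < δ ∧ ∀ᶠ z in 𝓝[closure Ω] x, δ * ρ z ≤ h (P t z) := by
  obtain ⟨c, hc, hQ⟩ := (F.oblique_pos hΩ hΩ' hρ hh ht hx).1
  set N := ∇ ρ x with hN
  have hN0 : 0 < ⟪N, N⟫ := real_inner_self_pos.2 (hρ.grad_ne x hx)
  refine ⟨c / 2, half_pos hc, ?_⟩
  set g : EucSp n → EucSp n := fun y => Q t y (∇ h (P t y)) - (c / 2) • ∇ ρ y with hg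
  have hfd : ∀ y ∈ closure Ω, HasFDerivWithinAt (fun y => h (P t y) - c / 2 * ρ y)
      (innerSL ℝ (g y)) (closure Ω) y := by
    intro y hy
    have h1 := (F.hasFDerivWithinAt_comp_gradient hh.smooth ht hy).sub
      ((hasFDerivAt_gradient hρ.smooth y).hasFDerivWithinAt.const_mul (c / 2))
    simp only [hg, map_sub, map_smul]
    exact h1
  have hslice : ContinuousOn (fun y : EucSp n => (t, y)) (closure Ω) := by fun_prop
  have hmaps : MapsTo (fun y : EucSp n => (t, y)) (closure Ω) (Icc 0 T ×ˢ closure Ω) :=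
    fun y hy => ⟨ht, hy⟩
  have hPc : ContinuousOn (P t) (closure Ω) := F.cont_P.comp hslice hmaps
  have hQc : ContinuousOn (Q t) (closure Ω) := F.cont_Q.comp hslice hmaps
  have hgc : ContinuousOn g (closure Ω) :=
    (hQc.clm_apply ((contDiff_gradient hh.smooth).continuous.comp_continuousOn hPc)).sub
      ((contDiff_gradient hρ.smooth).continuous.const_smul (c / 2)).continuousOn
  have hgx : 0 < ⟪g x, N⟫ := by
    have : g x = (c / 2) • N := by
      simp only [hg, hQ, ← hN, ← sub_smul]; congr 1; ring
    rw [this, real_inner_smul_left]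
    positivity
  have hev : ∀ᶠ y in 𝓝[closure Ω] x, 0 < ⟪g y, N⟫ :=
    ((hgc x hx.1).inner continuousWithinAt_const).eventually (lt_mem_nhds hgx)
  obtain ⟨R, hR, hball⟩ := Metric.mem_nhdsWithin_iff.1 hev
  obtain ⟨s, hs1, hs2, hs0⟩ : ∃ s : ℝ, x - s • N ∉ closure Ω ∧ ‖s • N‖ < R / 2 ∧ 0 < s := by
    have hlim : Tendsto (fun s : ℝ => ‖s • N‖) (𝓝[>] 0) (𝓝 0) := by
      have : Continuous fun s : ℝ => ‖s • N‖ := by fun_prop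
      simpa using (this.tendsto 0).mono_left nhdsWithin_le_nhds
    exact ((hρ.eventually_notMem_closure hx).and
      ((hlim.eventually (gt_mem_nhds (half_pos hR))).and self_mem_nhdsWithin)).exists
  have hout : ∀ᶠ z in 𝓝 x, z - s • N ∉ closure Ω :=
    (continuous_id.sub continuous_const).continuousAt.eventually
      (isClosed_closure.isOpen_compl.mem_nhds hs1)
  filter_upwards [nhdsWithin_le_nhds hout, nhdsWithin_le_nhds (Metric.ball_mem_nhds x (half_pos hR)),
    self_mem_nhdsWithin] with z hzout hzball hz
  -- the segment from `z` in the outward direction leaves `closure Ω` at a boundary point near `x`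
  obtain ⟨y, hyseg, hyfr⟩ : ∃ y ∈ segment ℝ z (z - s • N), y ∈ frontier Ω := by
    by_contra! hno
    have hcase : ∀ y ∈ segment ℝ z (z - s • N), y ∈ closure Ω → y ∈ Ω := fun y hy hyc => by
      by_contra hyn
      exact hno y hy (by rw [hΩ.isOpen.frontier_eq]; exact ⟨hyc, hyn⟩)
    obtain ⟨y, -, hy1, hy2⟩ := (convex_segment z (z - s • N)).isPreconnected Ω (closure Ω)ᶜ
      hΩ.isOpen isClosed_closure.isOpen_compl
      (fun y hy => (em (y ∈ closure Ω)).imp (hcase y hy) id)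
      ⟨z, left_mem_segment _ _ _, hcase z (left_mem_segment _ _ _) hz⟩
      ⟨_, right_mem_segment _ _ _, hzout⟩
    exact hy2 (subset_closure hy1)
  have hwball : z - s • N ∈ Metric.ball x R := by
    rw [Metric.mem_ball, dist_eq_norm] at hzball ⊢
    have e : z - s • N - x = (z - x) - s • N := by abel
    rw [e]
    linarith [norm_sub_le (z - x) (s • N)]
  have hyball : y ∈ Metric.ball x R := (convex_ball x R).segment_subset
    (Metric.ball_subset_ball (half_le_self hR.le) hzball) hwball hyseg
  obtain ⟨a, ha, hyz⟩ : ∃ a : ℝ, 0 ≤ a ∧ z - y = a • N := by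
    rw [segment_eq_image'] at hyseg
    obtain ⟨θ, hθ, rfl⟩ := hyseg
    refine ⟨θ * s, mul_nonneg hθ.1 hs0.le, ?_⟩
    simp [mul_smul]
  have hseg : ∀ b ∈ Icc (0 : ℝ) 1, y + b • (z - y) ∈ closure Ω := fun b hb =>
    hΩ.convex.closure.add_smul_sub_mem hyfr.1 hz hb
  have hsegb : ∀ b ∈ Icc (0 : ℝ) 1, y + b • (z - y) ∈ Metric.ball x R := fun b hb =>
    (convex_ball x R).add_smul_sub_mem hyball
      (Metric.ball_subset_ball (half_le_self hR.le) hzball) hb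
  have hline : ∀ b : ℝ, HasDerivAt (fun b : ℝ => y + b • (z - y)) (z - y) b := fun b => by
    simpa using ((hasDerivAt_id b).smul_const (z - y)).const_add y
  have hd : ∀ b ∈ Icc (0 : ℝ) 1, HasDerivWithinAt
      ((fun y => h (P t y) - c / 2 * ρ y) ∘ fun b : ℝ => y + b • (z - y))
      ⟪g (y + b • (z - y)), z - y⟫ (Icc 0 1) b := by
    intro b hb
    have h1 := (hfd _ (hseg b hb)).comp_hasDerivWithinAt b
      (hline b).hasDerivWithinAt (fun b hb => hseg b hb)
    rw [innerSL_apply_apply] at h1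
    exact h1
  have hi : ∀ b ∈ interior (Icc (0 : ℝ) 1), HasDerivAt
      ((fun y => h (P t y) - c / 2 * ρ y) ∘ fun b : ℝ => y + b • (z - y))
      ⟪g (y + b • (z - y)), z - y⟫ b := by
    intro b hb
    have hb' := interior_subset hb
    rw [interior_Icc] at hb
    exact (hd b hb').hasDerivAt (Icc_mem_nhds hb.1 hb.2)
  have hmono := monotoneOn_of_deriv_nonneg (convex_Icc (0 : ℝ) 1)
    (fun b hb => (hd b hb).continuousWithinAt)
    (fun b hb => (hi b hb).differentiableAt.differentiableWithinAt)
    (fun b hb => by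
      have hb' := interior_subset hb
      rw [(hi b hb).deriv, hyz, real_inner_smul_right, ← hyz]
      exact mul_nonneg ha (hball ⟨hsegb b hb', hseg b hb'⟩).le)
  have h1 := hmono (left_mem_Icc.2 zero_le_one) (right_mem_Icc.2 zero_le_one) zero_le_one
  simp only [Function.comp_apply, zero_smul, add_zero, one_smul, add_sub_cancel,
    hρ.eq_zero hyfr, hh.eq_zero (F.gradient_mem_frontier hΩ hΩ' ht hyfr)] at h1
  linarith

/-- At a fixed time, `h(Du)` dominates a positive multiple of the boundary defining function of
`Ω`. -/
lemma exists_mul_le (F : ConvexFlow Ω Ω' T U P Q V) (hΩ : IsUniformlyConvexDomain Ω)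
    (hΩ' : IsUniformlyConvexDomain Ω') {ρ h : EucSp n → ℝ} (hρ : IsBoundaryDefining Ω ρ)
    (hh : IsBoundaryDefining Ω' h) {t : ℝ} (ht : t ∈ Icc 0 T) :
    ∃ δ : ℝ, 0 < δ ∧ ∀ x ∈ closure Ω, δ * ρ x ≤ h (P t x) := by
  have key : ∃ δ : ℝ, 0 < δ ∧ ∀ x ∈ closure Ω, x ∈ closure Ω → δ * ρ x ≤ h (P t x) := by
    refine hΩ.isCompact.induction_on
      (p := fun s => ∃ δ : ℝ, 0 < δ ∧ ∀ x ∈ s, x ∈ closure Ω → δ * ρ x ≤ h (P t x))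
      ⟨1, one_pos, by simp⟩ ?_ ?_ ?_
    · rintro s s' hss ⟨δ, hδ, hs⟩
      exact ⟨δ, hδ, fun x hx => hs x (hss hx)⟩
    · rintro s s' ⟨δ, hδ, hs⟩ ⟨δ', hδ', hs'⟩
      refine ⟨min δ δ', lt_min hδ hδ', ?_⟩
      rintro x (hx | hx) hxc
      · exact (mul_le_mul_of_nonneg_right (min_le_left _ _) (hρ.nonneg hxc)).trans (hs x hx hxc)
      · exact (mul_le_mul_of_nonneg_right (min_le_right _ _) (hρ.nonneg hxc)).trans (hs' x hx hxc)
    · intro x hx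
      suffices ∃ δ : ℝ, 0 < δ ∧ ∀ᶠ z in 𝓝[closure Ω] x, δ * ρ z ≤ h (P t z) by
        obtain ⟨δ, hδ, hev⟩ := this
        exact ⟨_, hev, δ, hδ, fun z hz _ => hz⟩
      by_cases hin : x ∈ Ω
      · have hPx : 0 < h (P t x) := by
          have : P t x ∈ Ω' := by rw [← F.image t ht]; exact mem_image_of_mem _ hin
          rw [hh.eq_pos] at this
          exact this
        have hρx := hρ.nonneg hx
        refine ⟨h (P t x) / (ρ x + 1), by positivity, ?_⟩
        have hlt : h (P t x) / (ρ x + 1) * ρ x < h (P t x) := by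
          rw [div_mul_eq_mul_div, div_lt_iff₀ (by positivity)]
          nlinarith
        have hc1 : ContinuousWithinAt (fun z => h (P t x) / (ρ x + 1) * ρ z) (closure Ω) x :=
          (continuous_const.mul hρ.smooth.continuous).continuousWithinAt
        have hc2 : ContinuousWithinAt (fun z => h (P t z)) (closure Ω) x :=
          (F.hasFDerivWithinAt_comp_gradient hh.smooth ht hx).continuousWithinAt
        exact (hc1.eventually_lt hc2 hlt).mono fun z hz => hz.le
      · exact F.eventually_mul_le_of_frontier hΩ hΩ' hρ hh ht
          (by rw [hΩ.isOpen.frontier_eq]; exact ⟨hx, hin⟩)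
  obtain ⟨δ, hδ, hk⟩ := key
  exact ⟨δ, hδ, fun x hx => hk x hx hx⟩

end ConvexFlow

/-! ### The equation for `h(Du)` and the lower barrier -/

lemma add_le_minkOp {n : ℕ} {p : EucSp n} {A B Q : EucSp n →L[ℝ] EucSp n} {r θ : ℝ} (hr : r < 1)
    (hp : ‖p‖ ≤ r) (hθ : 0 ≤ θ) (hle : ∀ v, ⟪B v, v⟫ + θ * ‖Q v‖ ^ 2 ≤ ⟪A v, v⟫) :
    minkOp p B + θ * ∑ i, ‖Q (EuclideanSpace.basisFun (Fin n) ℝ i)‖ ^ 2 ≤ minkOp p A := by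
  have h1 := (one_sub_sq_pos hr hp).trans_le (one_sub_sq_le hp)
  have h2 : ⟪B p, p⟫ / (1 - ‖p‖ ^ 2) ≤ ⟪A p, p⟫ / (1 - ‖p‖ ^ 2) := by
    gcongr
    have := hle p
    have : 0 ≤ θ * ‖Q p‖ ^ 2 := by positivity
    linarith
  have h3 : frameTrace B + θ * ∑ i, ‖Q (EuclideanSpace.basisFun (Fin n) ℝ i)‖ ^ 2
      ≤ frameTrace A := by
    rw [frameTrace, frameTrace, Finset.mul_sum, ← Finset.sum_add_distrib]
    exact Finset.sum_le_sum fun i _ => hle _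
  unfold minkOp
  linarith

lemma hasDerivAt_minkOp {n : ℕ} {p : ℝ → EucSp n} {A : ℝ → EucSp n →L[ℝ] EucSp n} {p' : EucSp n}
    {A' : EucSp n →L[ℝ] EucSp n} {s : ℝ} (hp : HasDerivAt p p' s) (hA : HasDerivAt A A' s)
    (hs : ∀ v w, ⟪A s v, w⟫ = ⟪v, A s w⟫) (h1 : ‖p s‖ < 1) :
    HasDerivAt (fun s => minkOp (p s) (A s)) (minkOp (p s) A'
      + 2 * ⟪A s (p s), p'⟫ / (1 - ‖p s‖ ^ 2)
      + 2 * ⟪A s (p s), p s⟫ * ⟪p s, p'⟫ / (1 - ‖p s‖ ^ 2) ^ 2) s := by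
  have hne : 1 - ‖p s‖ ^ 2 ≠ 0 := by nlinarith [norm_nonneg (p s)]
  have ht : HasDerivAt (fun s => frameTrace (A s)) (frameTrace A') s := by
    unfold frameTrace
    refine HasDerivAt.fun_sum fun i _ => ?_
    have := (hA.clm_apply (hasDerivAt_const s (EuclideanSpace.basisFun (Fin n) ℝ i))).inner ℝ
      (hasDerivAt_const s (EuclideanSpace.basisFun (Fin n) ℝ i))
    simpa using this
  have hq := ((hA.clm_apply hp).inner ℝ hp).div (hp.norm_sq.const_sub 1) hne
  have e : ⟪A s p', p s⟫ = ⟪A s (p s), p'⟫ := by rw [hs, real_inner_comm]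
  refine (ht.add hq).congr_deriv ?_
  simp only [minkOp, inner_add_left, e]
  field_simp
  ring

/-- Differentiating the flow equation: at a point where `h(Du) - δρ` is critical with nonnegative
Hessian, the time derivative `⟪β, Du_t⟫` of `h(Du)` is bounded from below. The uniform concavity of
`h` produces the positive term; `Rβ` below denotes the third derivative of `u` in the direction
`β = Dh(Du)`. -/
lemma ConvexFlow.le_inner_time_deriv {n : ℕ} {Ω Ω' : Set (EucSp n)} {T r θ δ M G W : ℝ}
    {U : ℝ → EucSp n → ℝ} {P : ℝ → EucSp n → EucSp n}
    {Q : ℝ → EucSp n → EucSp n →L[ℝ] EucSp n} {V : ℝ → EucSp n → ℝ}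
    (F : ConvexFlow Ω Ω' T U P Q V) (hΩ : IsOpen Ω)
    {ρ h : EucSp n → ℝ} (hρ : ContDiff ℝ ∞ ρ) (hh : ContDiff ℝ ∞ h)
    (hr : r < 1) (hr' : ∀ p ∈ closure Ω', ‖p‖ ≤ r) (hθ : 0 ≤ θ) (hδ : 0 ≤ δ)
    (hconc : ∀ p ∈ Ω', ∀ ξ, ⟪hessMap h p ξ, ξ⟫ ≤ -θ * ‖ξ‖ ^ 2)
    {t : ℝ} (ht : t ∈ Icc 0 T) {x : EucSp n} (hx : x ∈ Ω)
    (hM : frameTrace (Q t x) ≤ M) (hG : ‖∇ ρ x‖ ≤ G) (hW : ‖hessMap ρ x‖ ≤ W)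
    (hreg : ContDiffAt ℝ 2 (P t) x) {g : EucSp n}
    (hV : HasFDerivAt (V t) (innerSL ℝ g) x)
    (hmin : IsLocalMin (fun y => h (P t y) - δ * ρ y) x) :
    θ * ∑ i, ‖Q t x (EuclideanSpace.basisFun (Fin n) ℝ i)‖ ^ 2
      - δ * ((n + 1 / (1 - r ^ 2)) * W + 2 * (M * G) / (1 - r ^ 2)
        + 2 * (M * G) / (1 - r ^ 2) ^ 2) ≤ ⟪∇ h (P t x), g⟫ := by
  set β := ∇ h (P t x) with hβ
  have hxc : x ∈ closure Ω := subset_closure hx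
  have hnh : ∀ y ∈ Ω, closure Ω ∈ 𝓝 y := fun y hy =>
    mem_of_superset (hΩ.mem_nhds hy) subset_closure
  have hPd : ∀ y ∈ Ω, HasFDerivAt (P t) (Q t y) y := fun y hy =>
    (F.grad_deriv t ht y (subset_closure hy)).hasFDerivAt (hnh y hy)
  have hQf : Q t =ᶠ[𝓝 x] fderiv ℝ (P t) := by
    filter_upwards [hΩ.mem_nhds hx] with y hy using (hPd y hy).fderiv.symm
  set R := fderiv ℝ (fderiv ℝ (P t)) x with hR
  have hQd : HasFDerivAt (Q t) R x :=
    (((hreg.fderiv_right (m := 1) (by norm_num)).differentiableAt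
      (by norm_num)).hasFDerivAt).congr_of_eventuallyEq hQf
  have hRs : ∀ v w, R v w = R w v := (hreg.isSymmSndFDerivAt (by simp)).eq
  have hsym := F.symm t ht x hxc
  -- criticality and the second-order condition for the gradient field of `δρ - h(Du)`
  have hdneg : ∀ᶠ y in 𝓝 x, HasFDerivAt (fun y => -(h (P t y) - δ * ρ y))
      (innerSL ℝ (-(Q t y (∇ h (P t y)) - δ • ∇ ρ y))) y := by
    filter_upwards [hΩ.mem_nhds hx] with y hy
    have h1 := (((F.hasFDerivWithinAt_comp_gradient hh ht (subset_closure hy)).hasFDerivAt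
      (hnh y hy)).sub ((hasFDerivAt_gradient hρ y).const_mul δ)).neg
    simp only [map_neg, map_sub, map_smul]
    exact h1
  have hβd : HasFDerivAt (fun y => ∇ h (P t y)) ((hessMap h (P t x)).comp (Q t x)) x :=
    (hasFDerivAt_hessMap hh (P t x)).comp x (hPd x hx)
  have hdd : HasFDerivAt (fun y => -(Q t y (∇ h (P t y)) - δ • ∇ ρ y))
      (-((Q t x).comp ((hessMap h (P t x)).comp (Q t x)) + R.flip β - δ • hessMap ρ x)) x :=
    ((hQd.clm_apply hβd).sub ((hasFDerivAt_hessMap hρ x).const_smul δ)).neg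
  obtain ⟨hcrit, hsnd⟩ := hmin.neg.gradient_eq_zero_and_hessian_nonpos hdneg hdd
  have hQβ : Q t x β = δ • ∇ ρ x := sub_eq_zero.1 (neg_eq_zero.1 hcrit)
  have hPmem : P t x ∈ Ω' := by rw [← F.image t ht]; exact mem_image_of_mem _ hx
  have hRβ : ∀ v, ⟪(δ • hessMap ρ x) v, v⟫ + θ * ‖Q t x v‖ ^ 2 ≤ ⟪R β v, v⟫ := by
    intro v
    have h1 := hsnd v
    have h2 := hconc _ hPmem (Q t x v)
    rw [neg_apply, inner_neg_left, sub_apply, add_apply, inner_sub_left, inner_add_left,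
      ContinuousLinearMap.flip_apply, hRs v β, ContinuousLinearMap.comp_apply,
      ContinuousLinearMap.comp_apply, hsym] at h1
    linarith
  have hp : ‖P t x‖ ≤ r := hr' _ (subset_closure hPmem)
  have h0 := one_sub_sq_pos hr hp
  have hle := one_sub_sq_le hp
  have hmain := add_le_minkOp hr hp hθ hRβ
  -- the derivative of the equation in the direction `β`
  have hline : HasDerivAt (fun s : ℝ => x + s • β) β 0 := by
    simpa using ((hasDerivAt_id (0 : ℝ)).smul_const β).const_add x
  have hlim : Tendsto (fun s : ℝ => x + s • β) (𝓝 0) (𝓝 x) := by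
    simpa using hline.continuousAt.tendsto
  have hx0 : x + (0 : ℝ) • β = x := by simp
  have d1 : HasDerivAt (fun s : ℝ => V t (x + s • β)) ⟪g, β⟫ 0 := by
    have := HasFDerivAt.comp_hasDerivAt (0 : ℝ) (f := fun s : ℝ => x + s • β)
      (by rw [hx0]; exact hV) hline
    rw [innerSL_apply_apply] at this
    exact this
  have d2 : HasDerivAt (fun s : ℝ => P t (x + s • β)) (Q t x β) 0 :=
    HasFDerivAt.comp_hasDerivAt (0 : ℝ) (f := fun s : ℝ => x + s • β)
      (by rw [hx0]; exact hPd x hx) hline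
  have d3 : HasDerivAt (fun s : ℝ => Q t (x + s • β)) (R β) 0 :=
    HasFDerivAt.comp_hasDerivAt (0 : ℝ) (f := fun s : ℝ => x + s • β) (by rwa [hx0]) hline
  have d4 := hasDerivAt_minkOp d2 d3 (by rw [hx0]; exact hsym)
    (by rw [hx0]; exact hp.trans_lt hr)
  have d5 : (fun s : ℝ => V t (x + s • β)) =ᶠ[𝓝 0]
      fun s => minkOp (P t (x + s • β)) (Q t (x + s • β)) := by
    filter_upwards [hlim.eventually (hΩ.mem_nhds hx)] with s hs
    exact F.equation t ht _ (subset_closure hs)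
  have heq := d1.unique (d4.congr_of_eventuallyEq d5)
  rw [hx0] at heq
  rw [real_inner_comm, heq]
  -- the remaining terms contain `D²u β = δ Dρ` and are of order `δ`
  have hnn := F.nonneg ht hxc
  have hM0 : 0 ≤ M := (Finset.sum_nonneg fun i _ => hnn _).trans hM
  have hp1 : ‖P t x‖ ≤ 1 := hp.trans hr.le
  have hQP : ‖Q t x (P t x)‖ ≤ M := by
    refine (norm_map_le hsym hnn _).trans ?_
    calc frameTrace (Q t x) * ‖P t x‖ ≤ M * 1 := by gcongr
      _ = M := mul_one M
  have hnβ : ‖Q t x β‖ ≤ δ * G := by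
    rw [hQβ, norm_smul, Real.norm_of_nonneg hδ]; gcongr
  have b1 : |2 * ⟪Q t x (P t x), Q t x β⟫ / (1 - ‖P t x‖ ^ 2)|
      ≤ 2 * (M * (δ * G)) / (1 - r ^ 2) := by
    rw [abs_div, abs_of_pos (h0.trans_le hle), abs_mul, abs_two]
    have : |⟪Q t x (P t x), Q t x β⟫| ≤ M * (δ * G) :=
      (abs_real_inner_le_norm _ _).trans (by gcongr)
    have hG0 : 0 ≤ G := (norm_nonneg _).trans hG
    gcongr
  have b2 : |2 * ⟪Q t x (P t x), P t x⟫ * ⟪P t x, Q t x β⟫ / (1 - ‖P t x‖ ^ 2) ^ 2|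
      ≤ 2 * (M * (δ * G)) / (1 - r ^ 2) ^ 2 := by
    rw [abs_div, abs_of_pos (pow_pos (h0.trans_le hle) 2), abs_mul, abs_mul, abs_two, mul_assoc]
    have a1 : |⟪Q t x (P t x), P t x⟫| ≤ M := by
      refine (abs_real_inner_le_norm _ _).trans ?_
      calc ‖Q t x (P t x)‖ * ‖P t x‖ ≤ M * 1 := by gcongr
        _ = M := mul_one M
    have a2 : |⟪P t x, Q t x β⟫| ≤ δ * G := by
      refine (abs_real_inner_le_norm _ _).trans ?_
      calc ‖P t x‖ * ‖Q t x β‖ ≤ 1 * (δ * G) := by gcongr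
        _ = δ * G := one_mul _
    have hG0 : 0 ≤ G := (norm_nonneg _).trans hG
    gcongr
  have b3 : |minkOp (P t x) (δ • hessMap ρ x)| ≤ δ * ((n + 1 / (1 - r ^ 2)) * W) := by
    rw [minkOp_smul, abs_mul, abs_of_nonneg hδ]
    have := (abs_minkOp_le (Q := hessMap ρ x) hr hp)
    have h2 : (n + 1 / (1 - r ^ 2)) * ‖hessMap ρ x‖ ≤ (n + 1 / (1 - r ^ 2)) * W := by gcongr
    exact mul_le_mul_of_nonneg_left (this.trans h2) hδ
  have c1 := (neg_le_abs _).trans b1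
  have c2 := (neg_le_abs _).trans b2
  have c3 := (neg_le_abs _).trans b3
  have e : δ * ((n + 1 / (1 - r ^ 2)) * W + 2 * (M * G) / (1 - r ^ 2)
      + 2 * (M * G) / (1 - r ^ 2) ^ 2) = δ * ((n + 1 / (1 - r ^ 2)) * W)
      + 2 * (M * (δ * G)) / (1 - r ^ 2) + 2 * (M * (δ * G)) / (1 - r ^ 2) ^ 2 := by
    ring
  rw [e]
  linarith

/-- The lower barrier: `δρ ≤ h(Du)` is preserved by the flow for small `δ`, since `δρ` is a strict
subsolution of the equation satisfied by `h(Du)`. -/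
lemma ConvexFlow.mul_le_comp_gradient {n : ℕ} {Ω Ω' : Set (EucSp n)} {T r θ δ m M G W : ℝ}
    {U : ℝ → EucSp n → ℝ} {P : ℝ → EucSp n → EucSp n}
    {Q : ℝ → EucSp n → EucSp n →L[ℝ] EucSp n} {V : ℝ → EucSp n → ℝ}
    (F : ConvexFlow Ω Ω' T U P Q V)
    (hΩ : IsUniformlyConvexDomain Ω) (hΩ' : IsUniformlyConvexDomain Ω')
    {ρ h : EucSp n → ℝ} (hρ : IsBoundaryDefining Ω ρ) (hh : IsBoundaryDefining Ω' h)
    (hr : r < 1) (hr' : ∀ p ∈ closure Ω', ‖p‖ ≤ r) (hT : 0 < T) (hθ : 0 < θ) (hδ : 0 ≤ δ)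
    (hconc : ∀ p ∈ Ω', ∀ ξ, ⟪hessMap h p ξ, ξ⟫ ≤ -θ * ‖ξ‖ ^ 2)
    (hm : 0 ≤ m) (hmQ : ∀ t ∈ Icc 0 T, ∀ x ∈ closure Ω, m ≤ frameTrace (Q t x))
    (hMQ : ∀ t ∈ Icc 0 T, ∀ x ∈ closure Ω, frameTrace (Q t x) ≤ M)
    (hG : ∀ x ∈ closure Ω, ‖∇ ρ x‖ ≤ G) (hW : ∀ x ∈ closure Ω, ‖hessMap ρ x‖ ≤ W)
    (hsmall : n * (δ * ((n + 1 / (1 - r ^ 2)) * W + 2 * (M * G) / (1 - r ^ 2)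
        + 2 * (M * G) / (1 - r ^ 2) ^ 2)) < θ * m ^ 2)
    (hreg : ∀ t ∈ Ioo 0 T, ∀ x ∈ Ω, ContDiffAt ℝ 2 (P t) x)
    (hmix : ∀ t ∈ Ioo 0 T, ∀ x ∈ Ω, ∃ g, HasFDerivAt (V t) (innerSL ℝ g) x ∧
      HasDerivAt (fun s => P s x) g t)
    (h0 : ∀ x ∈ closure Ω, δ * ρ x ≤ h (P 0 x)) {t : ℝ} (ht : t ∈ Icc 0 T) {x : EucSp n}
    (hx : x ∈ closure Ω) : δ * ρ x ≤ h (P t x) := by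
  have hslice : ContinuousOn (fun s => -h (P s x)) (Icc 0 T) :=
    (hh.smooth.continuous.comp_continuousOn (F.cont_P.comp (f := fun s : ℝ => (s, x))
      (by fun_prop) fun s hs => ⟨hs, hx⟩)).neg
  refine neg_le_neg_iff.1 (le_of_forall_Ico_le hT hslice (fun t ht => neg_le_neg ?_) ht)
  by_contra! hlt
  have hIcc : Icc 0 t ⊆ Icc 0 T := Icc_subset_Icc_right ht.2.le
  have hcont : ContinuousOn (fun q : ℝ × EucSp n => h (P q.1 q.2) - δ * ρ q.2)
      (Icc 0 t ×ˢ closure Ω) :=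
    (hh.smooth.continuous.comp_continuousOn (F.cont_P.mono (prod_mono hIcc subset_rfl))).sub
      (continuous_const.mul (hρ.smooth.continuous.comp continuous_snd)).continuousOn
  obtain ⟨⟨t₀, x₀⟩, ⟨ht₀, hx₀⟩, hmin⟩ := (isCompact_Icc.prod hΩ.isCompact).exists_isMinOn
    ⟨(t, x), right_mem_Icc.2 ht.1, hx⟩ hcont
  have ht₀ : t₀ ∈ Icc 0 t := ht₀
  have hx₀ : x₀ ∈ closure Ω := hx₀
  have hmin : ∀ s ∈ Icc 0 t, ∀ y ∈ closure Ω,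
      h (P t₀ x₀) - δ * ρ x₀ ≤ h (P s y) - δ * ρ y := fun s hs y hy =>
    isMinOn_iff.1 hmin (s, y) ⟨hs, hy⟩
  have hneg : h (P t₀ x₀) - δ * ρ x₀ < 0 :=
    (hmin t (right_mem_Icc.2 ht.1) x hx).trans_lt (by linarith)
  have htpos : 0 < t₀ := by
    refine ht₀.1.lt_of_ne fun he => ?_
    rw [← he] at hneg
    linarith [h0 x₀ hx₀]
  have ht₀T : t₀ ∈ Ioo 0 T := ⟨htpos, ht₀.2.trans_lt ht.2⟩
  have hin : x₀ ∈ Ω := by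
    by_contra hout
    have hfr : x₀ ∈ frontier Ω := by
      rw [hΩ.isOpen.frontier_eq]; exact ⟨hx₀, hout⟩
    rw [hρ.eq_zero hfr, hh.eq_zero (F.gradient_mem_frontier hΩ hΩ' (hIcc ht₀) hfr)] at hneg
    simp at hneg
  obtain ⟨g, hg1, hg2⟩ := hmix t₀ ht₀T x₀ hin
  have hloc : IsLocalMin (fun y => h (P t₀ y) - δ * ρ y) x₀ := by
    filter_upwards [hΩ.isOpen.mem_nhds hin] with y hy using hmin t₀ ht₀ y (subset_closure hy)
  have hlow := F.le_inner_time_deriv hΩ.isOpen hρ.smooth hh.smooth hr hr' hθ.le hδ hconc (hIcc ht₀)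
    hin (hMQ t₀ (hIcc ht₀) x₀ hx₀) (hG x₀ hx₀) (hW x₀ hx₀) (hreg t₀ ht₀T x₀ hin) hg1 hloc
  have htime : HasDerivWithinAt (fun s => -h (P s x₀)) (-⟪∇ h (P t₀ x₀), g⟫) (Icc 0 t) t₀ := by
    have h1 := (hasFDerivAt_gradient hh.smooth (P t₀ x₀)).comp_hasDerivAt t₀ hg2
    rw [innerSL_apply_apply] at h1
    exact h1.neg.hasDerivWithinAt
  have hV := htime.nonneg_of_max_of_lt ht₀ htpos fun s hs => by
    have := hmin s hs x₀ hx₀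
    linarith
  have h2 := frameTrace_sq_le (Q t₀ x₀)
  have h3 := hmQ t₀ (hIcc ht₀) x₀ hx₀
  have h4 : m ^ 2 ≤ frameTrace (Q t₀ x₀) ^ 2 := by gcongr
  have h5 : θ * m ^ 2 ≤ θ * (n * ∑ i, ‖Q t₀ x₀ (EuclideanSpace.basisFun (Fin n) ℝ i)‖ ^ 2) := by
    gcongr; exact h4.trans h2
  have h6 := mul_le_mul_of_nonneg_left (hlow.trans (neg_nonneg.1 hV)) (Nat.cast_nonneg (α := ℝ) n)
  rw [mul_zero, mul_sub] at h6
  linarith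

/-! ### From classical solutions to the flow in nondivergence form -/

/-- The one-sided Hessian of a function on `closure Ω`, as an endomorphism of Euclidean space. -/
noncomputable def hessField {n : ℕ} (Ω : Set (EucSp n)) (f : EucSp n → ℝ) (x : EucSp n) :
    EucSp n →L[ℝ] EucSp n :=
  (rieszCLM n).comp (fderivWithin ℝ (fderivWithin ℝ f (closure Ω)) (closure Ω) x)

lemma inner_hessField {n : ℕ} {Ω : Set (EucSp n)} (hΩ : IsUniformlyConvexDomain Ω)
    (f : EucSp n → ℝ) {x : EucSp n} (hx : x ∈ closure Ω) (ξ η : EucSp n) :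
    ⟪hessField Ω f x ξ, η⟫ = hessOn Ω f x ξ η :=
  inner_rieszCLM_fderivWithin hΩ.uniqueDiffOn hx ξ η

lemma hessField_symm {n : ℕ} {Ω : Set (EucSp n)} (hΩ : IsUniformlyConvexDomain Ω)
    {f : EucSp n → ℝ} (hf : ContDiffOn ℝ 2 f (closure Ω)) {x : EucSp n} (hx : x ∈ closure Ω)
    (v w : EucSp n) : ⟪hessField Ω f x v, w⟫ = ⟪v, hessField Ω f x w⟫ := by
  have hx' : x ∈ closure (interior (closure Ω)) :=
    closure_mono (interior_maximal subset_closure hΩ.isOpen) hx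
  have h := (hf x hx).isSymmSndFDerivWithinAt (by simp) hΩ.uniqueDiffOn hx' hx
  have e : ∀ a b, ⟪hessField Ω f x a, b⟫ =
      fderivWithin ℝ (fderivWithin ℝ f (closure Ω)) (closure Ω) x a b := fun a b =>
    inner_rieszCLM _ _
  rw [e, real_inner_comm, e]
  exact h.eq v w

lemma continuousOn_of_inner {n : ℕ} {X : Type*} [TopologicalSpace X] {s : Set X}
    {f : X → EucSp n} (hf : ∀ v, ContinuousOn (fun x => ⟪f x, v⟫) s) : ContinuousOn f s := by
  have e : f = fun x => ∑ i, ⟪f x, EuclideanSpace.basisFun (Fin n) ℝ i⟫ •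
      EuclideanSpace.basisFun (Fin n) ℝ i := by
    funext x
    conv_lhs => rw [← (EuclideanSpace.basisFun (Fin n) ℝ).sum_repr' (f x)]
    simp only [real_inner_comm]
  rw [e]
  exact continuousOn_finsetSum _ fun i _ => (hf _).smul continuousOn_const

lemma continuousOn_gradOn {n : ℕ} {X : Type*} [TopologicalSpace X] {s : Set X} {S : Set (EucSp n)}
    (hS : UniqueDiffOn ℝ S) {f : X → EucSp n → ℝ} {y : X → EucSp n} (hy : ∀ q ∈ s, y q ∈ S)
    (hf : ContinuousOn (fun q => iteratedFDerivWithin ℝ 1 (f q) S (y q)) s) :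
    ContinuousOn (fun q => gradientWithin (f q) S (y q)) s := by
  refine continuousOn_of_inner fun v => ?_
  have h1 : ContinuousOn (fun q => iteratedFDerivWithin ℝ 1 (f q) S (y q) ![v]) s :=
    (ContinuousMultilinearMap.apply ℝ (fun _ : Fin 1 => EucSp n) ℝ
      ![v]).continuous.comp_continuousOn hf
  refine h1.congr fun q hq => ?_
  beta_reduce
  rw [iteratedFDerivWithin_one_apply (hS _ (hy q hq)), gradientWithin_eq_rieszCLM]
  exact inner_rieszCLM _ _

lemma continuousOn_hessField {n : ℕ} {X : Type*} [TopologicalSpace X] {s : Set X}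
    {Ω : Set (EucSp n)} (hΩ : IsUniformlyConvexDomain Ω) {f : X → EucSp n → ℝ} {y : X → EucSp n}
    (hy : ∀ q ∈ s, y q ∈ closure Ω)
    (hf : ContinuousOn (fun q => iteratedFDerivWithin ℝ 2 (f q) (closure Ω) (y q)) s) :
    ContinuousOn (fun q => hessField Ω (f q) (y q)) s := by
  refine continuousOn_clm_apply.2 fun v => continuousOn_of_inner fun w => ?_
  have h1 : ContinuousOn (fun q => iteratedFDerivWithin ℝ 2 (f q) (closure Ω) (y q) ![v, w]) s :=
    (ContinuousMultilinearMap.apply ℝ (fun _ : Fin 2 => EucSp n) ℝ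
      ![v, w]).continuous.comp_continuousOn hf
  exact h1.congr fun q hq => inner_hessField hΩ _ (hy q hq) v w

lemma gradOn_congr {n : ℕ} {Ω : Set (EucSp n)} {f g : EucSp n → ℝ} (h : EqOn f g (closure Ω))
    {x : EucSp n} (hx : x ∈ closure Ω) : gradOn Ω f x = gradOn Ω g x := by
  unfold gradOn gradientWithin
  rw [fderivWithin_congr h (h hx)]

lemma hessField_congr {n : ℕ} {Ω : Set (EucSp n)} {f g : EucSp n → ℝ} (h : EqOn f g (closure Ω))
    {x : EucSp n} (hx : x ∈ closure Ω) : hessField Ω f x = hessField Ω g x := by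
  have h1 : EqOn (fderivWithin ℝ f (closure Ω)) (fderivWithin ℝ g (closure Ω)) (closure Ω) :=
    fun y hy => fderivWithin_congr h (h hy)
  unfold hessField
  rw [fderivWithin_congr h1 (h1 hx)]

/-- The right-hand side of the flow in nondivergence form. -/
lemma sqrt_mul_divergence {n : ℕ} {P : EucSp n → EucSp n} {Q : EucSp n →L[ℝ] EucSp n}
    {x : EucSp n} (hP : HasFDerivAt P Q x) (hs : ∀ v w, ⟪Q v, w⟫ = ⟪v, Q w⟫) (h1 : ‖P x‖ < 1) :
    √(1 - ‖P x‖ ^ 2) * divergence (fun y => (√(1 - ‖P y‖ ^ 2))⁻¹ • P y) x = minkOp (P x) Q := by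
  have hpos : 0 < 1 - ‖P x‖ ^ 2 := by nlinarith [norm_nonneg (P x)]
  set σ := √(1 - ‖P x‖ ^ 2) with hσ
  have hσ0 : 0 < σ := Real.sqrt_pos.2 hpos
  have hσ2 : σ ^ 2 = 1 - ‖P x‖ ^ 2 := Real.sq_sqrt hpos.le
  have hψ : HasDerivAt (fun a : ℝ => (√(1 - a))⁻¹) (1 / (2 * σ ^ 3)) (‖P x‖ ^ 2) := by
    have h2 := (((hasDerivAt_id (‖P x‖ ^ 2)).const_sub 1).sqrt hpos.ne').inv hσ0.ne'
    refine h2.congr_deriv ?_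
    simp only [id]
    rw [← hσ]
    field_simp
  have hφ := hψ.comp_hasFDerivAt x hP.norm_sq
  have hfd := hφ.smul hP
  have hd : divergence (fun y => (√(1 - ‖P y‖ ^ 2))⁻¹ • P y) x =
      σ⁻¹ * frameTrace Q + σ⁻¹ ^ 3 * ⟪Q (P x), P x⟫ := by
    have e : fderiv ℝ (fun y => (√(1 - ‖P y‖ ^ 2))⁻¹ • P y) x = _ := hfd.fderiv
    rw [divergence, e, LinearMap.trace_eq_sum_inner _ (EuclideanSpace.basisFun (Fin n) ℝ)]
    have hsum := (EuclideanSpace.basisFun (Fin n) ℝ).sum_inner_mul_inner (Q (P x)) (P x)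
    rw [← hsum, frameTrace, Finset.mul_sum, Finset.mul_sum, ← Finset.sum_add_distrib]
    refine Finset.sum_congr rfl fun i _ => ?_
    simp only [ContinuousLinearMap.coe_coe, add_apply, smul_apply,
      ContinuousLinearMap.smulRight_apply, inner_add_right, real_inner_smul_right,
      Function.comp_apply, ContinuousLinearMap.comp_apply, innerSL_apply_apply, ← hσ,
      smul_eq_mul, nsmul_eq_mul]
    rw [hs (P x), real_inner_comm (Q _)]
    push_cast
    field_simp
  rw [hd, minkOp, ← hσ2]
  field_simp

/-- Exchange of the time derivative with the spatial gradient, when the gradient `G` of the time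
derivative `V` is continuous. -/
lemma hasDerivAt_gradient_of_mixed {n : ℕ} {I : Set ℝ} {Ω : Set (EucSp n)}
    {U V : ℝ → EucSp n → ℝ} {P G : ℝ → EucSp n → EucSp n} (hI : IsOpen I) (hΩ : IsOpen Ω)
    (hU : ∀ t ∈ I, ∀ x ∈ Ω, HasFDerivAt (U t) (innerSL ℝ (P t x)) x)
    (hUt : ∀ t ∈ I, ∀ x ∈ Ω, HasDerivAt (fun s => U s x) (V t x) t)
    (hV : ∀ t ∈ I, ∀ x ∈ Ω, HasFDerivAt (V t) (innerSL ℝ (G t x)) x)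
    (hG : ContinuousOn (fun q : ℝ × EucSp n => G q.1 q.2) (I ×ˢ Ω))
    {t : ℝ} (ht : t ∈ I) {x : EucSp n} (hx : x ∈ Ω) :
    HasDerivAt (fun s => P s x) (G t x) t := by
  rw [hasDerivAt_iff_isLittleO, Asymptotics.isLittleO_iff]
  intro ε hε
  have hopen : I ×ˢ Ω ∈ 𝓝 (t, x) := (hI.prod hΩ).mem_nhds ⟨ht, hx⟩
  obtain ⟨d, hd, hball⟩ := Metric.mem_nhds_iff.1 (inter_mem hopen
    ((hG.continuousAt hopen).preimage_mem_nhds (Metric.ball_mem_nhds (G t x) (half_pos hε))))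
  have hdom : ∀ s ∈ Metric.ball t d, ∀ y ∈ Metric.ball x d,
      s ∈ I ∧ y ∈ Ω ∧ ‖G s y - G t x‖ < ε / 2 := by
    intro s hs y hy
    have := hball (show (s, y) ∈ Metric.ball (t, x) d by
      rw [← ball_prod_same]; exact ⟨hs, hy⟩)
    exact ⟨this.1.1, this.1.2, by simpa [dist_eq_norm] using this.2⟩
  have htd := Metric.mem_ball_self (x := t) hd
  have hxd := Metric.mem_ball_self (x := x) hd
  -- the oscillation of `V s - V t` near `x` is small relative to the distance from `x`
  have hosc : ∀ s ∈ Metric.ball t d, ∀ y ∈ Metric.ball x d,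
      ‖(V s y - V t y) - (V s x - V t x)‖ ≤ ε * ‖y - x‖ := by
    intro s hs y hy
    refine (convex_ball x d).norm_image_sub_le_of_norm_hasFDerivWithin_le
      (f := fun y => V s y - V t y) (f' := fun y => innerSL ℝ (G s y) - innerSL ℝ (G t y))
      (fun z hz => ((hV s (hdom s hs z hz).1 z (hdom s hs z hz).2.1).sub
        (hV t ht z (hdom s hs z hz).2.1)).hasFDerivWithinAt) (fun z hz => ?_) hxd hy
    rw [← map_sub, innerSL_apply_norm]
    have h1 := (hdom s hs z hz).2.2
    have h2 := (hdom t htd z hz).2.2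
    have e : G s z - G t z = (G s z - G t x) - (G t z - G t x) := by abel
    rw [e]
    linarith [norm_sub_le (G s z - G t x) (G t z - G t x)]
  filter_upwards [Metric.ball_mem_nhds t hd] with s hs
  have hsI := (hdom s hs x hxd).1
  have hf : HasFDerivAt (fun y => U s y - U t y - (s - t) * V t y)
      (innerSL ℝ (P s x - P t x - (s - t) • G t x)) x := by
    have := ((hU s hsI x hx).sub (hU t ht x hx)).sub ((hV t ht x hx).const_mul (s - t))
    simp only [map_sub, map_smul]
    exact this
  have hlip := hf.le_of_lip' (C := ε * ‖s - t‖) (by positivity) (by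
    filter_upwards [Metric.ball_mem_nhds x hd] with y hy
    have hy' := (hdom t htd y hy).2.1
    have h1 := (convex_ball t d).norm_image_sub_le_of_norm_hasDerivWithin_le
      (f := fun σ => U σ y - U σ x - σ * (V t y - V t x))
      (f' := fun σ => V σ y - V σ x - (V t y - V t x)) (C := ε * ‖y - x‖)
      (fun σ hσ => by
        have h2 := ((hUt σ (hdom σ hσ x hxd).1 y hy').sub (hUt σ (hdom σ hσ x hxd).1 x hx)).sub
          ((hasDerivAt_id σ).mul_const (V t y - V t x))
        rw [one_mul] at h2
        exact h2.hasDerivWithinAt)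
      (fun σ hσ => by
        have h3 := hosc σ hσ y hy
        have e : V σ y - V σ x - (V t y - V t x) = (V σ y - V t y) - (V σ x - V t x) := by ring
        rw [e]
        exact h3) htd hs
    have e : (U s y - U t y - (s - t) * V t y) - (U s x - U t x - (s - t) * V t x) =
        (U s y - U s x - s * (V t y - V t x)) - (U t y - U t x - t * (V t y - V t x)) := by ring
    rw [e]
    calc _ ≤ ε * ‖y - x‖ * ‖s - t‖ := h1
      _ = _ := by ring)
  rwa [innerSL_apply_norm] at hlip

namespace IsStrictlyConvexSolution

variable {n : ℕ} {Ω Ω' : Set (EucSp n)} {T : ℝ} {u₀ : EucSp n → ℝ} {u : ℝ → EucSp n → ℝ}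

lemma contDiffOn_closure (hu : IsStrictlyConvexSolution Ω Ω' u₀ T u) {t : ℝ} (ht : t ∈ Icc 0 T) :
    ContDiffOn ℝ 2 (u t) (closure Ω) := by
  obtain ⟨α, -, -, h1, -⟩ := hu.regular
  simpa using h1.space 0 (by norm_num) t ht

lemma contDiffOn_interior (hu : IsStrictlyConvexSolution Ω Ω' u₀ T u) {t : ℝ} (ht : t ∈ Ioo 0 T) :
    ContDiffOn ℝ 4 (u t) Ω := by
  obtain ⟨α, -, -, -, h2⟩ := hu.regular
  simpa using h2.space 0 (by norm_num) t ht

lemma eqOn_initial (hu : IsStrictlyConvexSolution Ω Ω' u₀ T u) (hT : 0 ≤ T)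
    (hu₀ : ContinuousOn u₀ (closure Ω)) : EqOn (u 0) u₀ (closure Ω) :=
  EqOn.of_subset_closure (s := Ω) hu.initial
    (hu.contDiffOn_closure (left_mem_Icc.2 hT)).continuousOn hu₀ subset_closure subset_rfl

lemma gradOn_image (hu : IsStrictlyConvexSolution Ω Ω' u₀ T u)
    (hu₀ : ContinuousOn u₀ (closure Ω)) (hgrad : gradOn Ω u₀ '' Ω = Ω') {t : ℝ}
    (ht : t ∈ Icc 0 T) : gradOn Ω (u t) '' Ω = Ω' := by
  rcases ht.1.eq_or_lt with h | h
  · subst h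
    rw [← hgrad]
    exact image_congr fun x hx => gradOn_congr (hu.eqOn_initial ht.2 hu₀) (subset_closure hx)
  · exact hu.second_boundary t ⟨h, ht.2⟩

/-- A strictly convex solution in the sense of the flow equation in divergence form is a
`ConvexFlow`. The nondivergence equation extends from the open cylinder to its closure by
continuity. -/
lemma convexFlow (hu : IsStrictlyConvexSolution Ω Ω' u₀ T u) (hΩ : IsUniformlyConvexDomain Ω)
    (hball : closure Ω' ⊆ Metric.ball (0 : EucSp n) 1) (hT : 0 < T)
    (hu₀ : ContinuousOn u₀ (closure Ω)) (hgrad : gradOn Ω u₀ '' Ω = Ω') :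
    ConvexFlow Ω Ω' T u (fun t => gradOn Ω (u t)) (fun t => hessField Ω (u t))
      (fun t x => derivWithin (fun s => u s x) (Icc 0 T) t) := by
  obtain ⟨α, -, -, hreg, -⟩ := hu.regular
  have hS := hΩ.uniqueDiffOn
  have hcU : ContinuousOn (fun q : ℝ × EucSp n => u q.1 q.2) (Icc 0 T ×ˢ closure Ω) := by
    have h1 := hreg.continuous 0 0 (by norm_num)
    have h2 := (ContinuousMultilinearMap.apply ℝ (fun _ : Fin 0 => EucSp n) ℝ
      ![]).continuous.comp_continuousOn h1
    refine h2.congr fun q hq => ?_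
    simp [parDeriv]
  have hcP : ContinuousOn (fun q : ℝ × EucSp n => gradOn Ω (u q.1) q.2)
      (Icc 0 T ×ˢ closure Ω) := by
    have h1 := hreg.continuous 0 1 (by norm_num)
    simp only [parDeriv, iteratedDerivWithin_zero] at h1
    exact continuousOn_gradOn hS (fun q hq => hq.2) h1
  have hcQ : ContinuousOn (fun q : ℝ × EucSp n => hessField Ω (u q.1) q.2)
      (Icc 0 T ×ˢ closure Ω) := by
    have h1 := hreg.continuous 0 2 (by norm_num)
    simp only [parDeriv, iteratedDerivWithin_zero] at h1
    exact continuousOn_hessField hΩ (fun q hq => hq.2) h1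
  have hcV : ContinuousOn (fun q : ℝ × EucSp n =>
      derivWithin (fun s => u s q.2) (Icc 0 T) q.1) (Icc 0 T ×ˢ closure Ω) := by
    have h1 := hreg.continuous 1 0 (by norm_num)
    have h2 := (ContinuousMultilinearMap.apply ℝ (fun _ : Fin 0 => EucSp n) ℝ
      ![]).continuous.comp_continuousOn h1
    refine h2.congr fun q hq => ?_
    simp [parDeriv, iteratedDerivWithin_one]
  have hgd : ∀ t ∈ Icc 0 T, ∀ x ∈ closure Ω,
      HasFDerivWithinAt (gradOn Ω (u t)) (hessField Ω (u t) x) (closure Ω) x := fun t ht x hx =>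
    hasFDerivWithinAt_gradientWithin hS (hu.contDiffOn_closure ht) hx
  have hsym : ∀ t ∈ Icc 0 T, ∀ x ∈ closure Ω, ∀ v w,
      ⟪hessField Ω (u t) x v, w⟫ = ⟪v, hessField Ω (u t) x w⟫ := fun t ht x hx =>
    hessField_symm hΩ (hu.contDiffOn_closure ht) hx
  have himg : ∀ t ∈ Icc 0 T, gradOn Ω (u t) '' Ω = Ω' := fun t ht => hu.gradOn_image hu₀ hgrad ht
  have hnorm : ∀ t ∈ Icc 0 T, ∀ x ∈ closure Ω, ‖gradOn Ω (u t) x‖ < 1 := by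
    intro t ht x hx
    have hc : ContinuousOn (gradOn Ω (u t)) (closure Ω) :=
      fun y hy => (hgd t ht y hy).continuousWithinAt
    have h1 := hc.image_closure (mem_image_of_mem _ hx)
    rw [himg t ht] at h1
    simpa using hball h1
  have heq : EqOn (fun q : ℝ × EucSp n => derivWithin (fun s => u s q.2) (Icc 0 T) q.1)
      (fun q => minkOp (gradOn Ω (u q.1) q.2) (hessField Ω (u q.1) q.2))
      (Icc 0 T ×ˢ closure Ω) := by
    refine EqOn.of_subset_closure (s := Ioo 0 T ×ˢ Ω) ?_ hcV
      (continuous_minkOp_comp hcP hcQ fun q hq => hnorm q.1 hq.1 q.2 hq.2)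
      (prod_mono Ioo_subset_Icc_self subset_closure)
      (by rw [closure_prod_eq, closure_Ioo hT.ne])
    rintro ⟨t, x⟩ ⟨ht, hx⟩
    have ht : t ∈ Ioo 0 T := ht
    have hx : x ∈ Ω := hx
    have ht' := Ioo_subset_Icc_self ht
    have hxc := subset_closure hx
    beta_reduce
    rw [derivWithin_of_mem_nhds (Icc_mem_nhds ht.1 ht.2), hu.flow t ht x hx]
    exact sqrt_mul_divergence
      ((hgd t ht' x hxc).hasFDerivAt (mem_of_superset (hΩ.isOpen.mem_nhds hx) subset_closure))
      (hsym t ht' x hxc) (hnorm t ht' x hxc)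
  exact
    { space_deriv := fun t ht x hx => hasFDerivWithinAt_of_gradientWithin
        ((hu.contDiffOn_closure ht).differentiableOn (by norm_num) x hx)
      grad_deriv := hgd
      symm := hsym
      pos := fun t ht x hx v hv => by
        rw [inner_hessField hΩ _ hx]; exact hu.strictly_convex t ht x hx v hv
      time_deriv := fun t ht x hx =>
        ((hreg.time x hx).differentiableOn (by norm_num) t ht).hasDerivWithinAt
      cont_U := hcU
      cont_P := hcP
      cont_Q := hcQ
      cont_V := hcV
      equation := fun t ht x hx => heq (x := (t, x)) ⟨ht, hx⟩
      image := himg }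

lemma contDiffAt_gradOn (hu : IsStrictlyConvexSolution Ω Ω' u₀ T u) (hΩ : IsOpen Ω) {t : ℝ}
    (ht : t ∈ Ioo 0 T) {x : EucSp n} (hx : x ∈ Ω) : ContDiffAt ℝ 2 (gradOn Ω (u t)) x := by
  have h1 : ContDiffAt ℝ 4 (u t) x := (hu.contDiffOn_interior ht).contDiffAt (hΩ.mem_nhds hx)
  have h2 : ContDiffAt ℝ 2 (fun y => rieszCLM n (fderiv ℝ (u t) y)) x :=
    (rieszCLM n).contDiff.contDiffAt.comp x (h1.fderiv_right (by norm_num))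
  refine h2.congr_of_eventuallyEq ?_
  filter_upwards [hΩ.mem_nhds hx] with y hy
  rw [gradOn, gradientWithin_eq_rieszCLM,
    fderivWithin_of_mem_nhds (mem_of_superset (hΩ.mem_nhds hy) subset_closure)]

lemma exists_mixed_derivative (hu : IsStrictlyConvexSolution Ω Ω' u₀ T u) (hΩ : IsOpen Ω) {t : ℝ}
    (ht : t ∈ Ioo 0 T) {x : EucSp n} (hx : x ∈ Ω) :
    ∃ g, HasFDerivAt (fun x => derivWithin (fun s => u s x) (Icc 0 T) t) (innerSL ℝ g) x ∧
      HasDerivAt (fun s => gradOn Ω (u s) x) g t := by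
  obtain ⟨α, -, -, -, hreg⟩ := hu.regular
  have hS : UniqueDiffOn ℝ Ω := hΩ.uniqueDiffOn
  have hnh : ∀ y ∈ Ω, closure Ω ∈ 𝓝 y := fun y hy =>
    mem_of_superset (hΩ.mem_nhds hy) subset_closure
  have hVd : ∀ t ∈ Ioo 0 T, ∀ x ∈ Ω, HasFDerivAt (fun x => deriv (fun s => u s x) t)
      (innerSL ℝ (gradientWithin (fun x => deriv (fun s => u s x) t) Ω x)) x := by
    intro t ht x hx
    have h1 := hreg.space 1 (by norm_num) t ht
    have h2 : ContDiffOn ℝ 2 (fun x => deriv (fun s => u s x) t) Ω := by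
      refine ContDiffOn.congr (by simpa using h1) fun y hy => ?_
      rw [derivWithin_of_mem_nhds (Ioo_mem_nhds ht.1 ht.2)]
    exact (hasFDerivWithinAt_of_gradientWithin
      (h2.differentiableOn (by norm_num) x hx)).hasFDerivAt (hΩ.mem_nhds hx)
  have hG : ContinuousOn (fun q : ℝ × EucSp n =>
      gradientWithin (fun x => deriv (fun s => u s x) q.1) Ω q.2) (Ioo 0 T ×ˢ Ω) := by
    refine continuousOn_gradOn hS (fun q hq => hq.2) ?_
    refine (hreg.continuous 1 1 (by norm_num)).congr fun q hq => ?_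
    refine iteratedFDerivWithin_congr (fun y hy => ?_) hq.2 1
    rw [iteratedDerivWithin_one, derivWithin_of_mem_nhds (Ioo_mem_nhds hq.1.1 hq.1.2)]
  refine ⟨gradientWithin (fun x => deriv (fun s => u s x) t) Ω x, ?_, ?_⟩
  · have e : (fun x => derivWithin (fun s => u s x) (Icc 0 T) t) =
        fun x => deriv (fun s => u s x) t := by
      funext y
      rw [derivWithin_of_mem_nhds (Icc_mem_nhds ht.1 ht.2)]
    rw [e]
    exact hVd t ht x hx
  · refine hasDerivAt_gradient_of_mixed isOpen_Ioo hΩ (U := u)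
      (G := fun t x => gradientWithin (fun x => deriv (fun s => u s x) t) Ω x)
      (P := fun s => gradOn Ω (u s)) (fun s hs y hy => ?_)
      (fun s hs y hy => ?_) hVd hG ht hx
    · exact (hasFDerivWithinAt_of_gradientWithin
        ((hu.contDiffOn_closure (Ioo_subset_Icc_self hs)).differentiableOn (by norm_num) y
          (subset_closure hy))).hasFDerivAt (hnh y hy)
    · exact (((hreg.time y hy).differentiableOn (by norm_num) s hs).differentiableAt
        (Ioo_mem_nhds hs.1 hs.2)).hasDerivAt

end IsStrictlyConvexSolution

/-- The initial function alone, viewed as a flow on the degenerate time interval `[0, 0]`; this makes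
the boundary geometry of flows available for `u₀`. -/
lemma convexFlow_initial {n : ℕ} {Ω Ω' : Set (EucSp n)} (hΩ : IsUniformlyConvexDomain Ω)
    (hball : closure Ω' ⊆ Metric.ball (0 : EucSp n) 1) {u₀ : EucSp n → ℝ}
    (hu₀ : ContDiffOn ℝ 2 u₀ (closure Ω))
    (hconv : ∃ θ : ℝ, 0 < θ ∧ ∀ x ∈ closure Ω, ∀ ξ : EucSp n,
      θ * ‖ξ‖ ^ 2 ≤ hessOn Ω u₀ x ξ ξ)
    (hgrad : gradOn Ω u₀ '' Ω = Ω') :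
    ConvexFlow Ω Ω' 0 (fun _ => u₀) (fun _ => gradOn Ω u₀) (fun _ => hessField Ω u₀)
      (fun _ x => minkOp (gradOn Ω u₀ x) (hessField Ω u₀ x)) := by
  have hS := hΩ.uniqueDiffOn
  have hgd : ∀ x ∈ closure Ω,
      HasFDerivWithinAt (gradOn Ω u₀) (hessField Ω u₀ x) (closure Ω) x := fun x hx =>
    hasFDerivWithinAt_gradientWithin hS hu₀ hx
  have hcP : ContinuousOn (gradOn Ω u₀) (closure Ω) :=
    fun x hx => (hgd x hx).continuousWithinAt
  have hcQ : ContinuousOn (hessField Ω u₀) (closure Ω) :=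
    continuousOn_hessField hΩ (f := fun _ => u₀) (y := id) (fun q hq => hq)
      (hu₀.continuousOn_iteratedFDerivWithin (by norm_num) hS)
  have hnorm : ∀ x ∈ closure Ω, ‖gradOn Ω u₀ x‖ < 1 := by
    intro x hx
    have h1 := hcP.image_closure (mem_image_of_mem _ hx)
    rw [hgrad] at h1
    simpa using hball h1
  have hsnd : MapsTo (Prod.snd : ℝ × EucSp n → EucSp n) (Icc 0 0 ×ˢ closure Ω) (closure Ω) :=
    fun q hq => hq.2
  obtain ⟨θ, hθ, hconv⟩ := hconv
  exact
    { space_deriv := fun t ht x hx => hasFDerivWithinAt_of_gradientWithin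
        (hu₀.differentiableOn (by norm_num) x hx)
      grad_deriv := fun t ht => hgd
      symm := fun t ht x hx => hessField_symm hΩ hu₀ hx
      pos := fun t ht x hx v hv => by
        rw [inner_hessField hΩ _ hx]
        have : 0 < ‖v‖ := norm_pos_iff.2 hv
        exact (by positivity : 0 < θ * ‖v‖ ^ 2).trans_le (hconv x hx v)
      -- every number is a derivative within a one-point set
      time_deriv := fun t ht x hx => by
        rw [Icc_self] at ht ⊢
        rw [mem_singleton_iff.1 ht]
        exact hasDerivWithinAt_iff_hasFDerivWithinAt.2 HasFDerivWithinAt.singleton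
      cont_U := hu₀.continuousOn.comp continuousOn_snd hsnd
      cont_P := hcP.comp continuousOn_snd hsnd
      cont_Q := hcQ.comp continuousOn_snd hsnd
      cont_V := (continuous_minkOp_comp hcP hcQ hnorm).comp continuousOn_snd hsnd
      equation := fun t ht x hx => rfl
      image := fun t ht => hgrad }

/-! ### The uniform obliqueness estimate -/

/-- The obliqueness estimate from the barrier. Since `h(Du) - δρ` has a minimum at the boundary
point, `D²u β = λ Dρ` with `λ ≥ δ`, and `|D²u β|² ≤ tr(D²u) ⟪D²u β, β⟫` bounds `⟪β, Dρ⟫` below. -/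
lemma ConvexFlow.mul_le_inner {n : ℕ} {Ω Ω' : Set (EucSp n)} {T δ M : ℝ}
    {U : ℝ → EucSp n → ℝ} {P : ℝ → EucSp n → EucSp n}
    {Q : ℝ → EucSp n → EucSp n →L[ℝ] EucSp n} {V : ℝ → EucSp n → ℝ}
    (F : ConvexFlow Ω Ω' T U P Q V)
    (hΩ : IsUniformlyConvexDomain Ω) (hΩ' : IsUniformlyConvexDomain Ω')
    {ρ h : EucSp n → ℝ} (hρ : IsBoundaryDefining Ω ρ) (hh : IsBoundaryDefining Ω' h)
    (hδ : 0 < δ) {t : ℝ} (ht : t ∈ Icc 0 T) {x : EucSp n} (hx : x ∈ frontier Ω)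
    (hM : frameTrace (Q t x) ≤ M) (hbar : ∀ y ∈ closure Ω, δ * ρ y ≤ h (P t y)) :
    δ * ‖∇ ρ x‖ ^ 2 ≤ M * ⟪∇ ρ x, ∇ h (P t x)⟫ := by
  have hfd : HasFDerivWithinAt (fun y => h (P t y) - δ * ρ y)
      (innerSL ℝ (Q t x (∇ h (P t x)) - δ • ∇ ρ x)) (closure Ω) x := by
    have h1 := (F.hasFDerivWithinAt_comp_gradient hh.smooth ht hx.1).sub
      ((hasFDerivAt_gradient hρ.smooth x).hasFDerivWithinAt.const_mul δ)
    simp only [map_sub, map_smul]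
    exact h1
  obtain ⟨c, hc, hg⟩ := hρ.gradient_of_min hx hfd (fun y hy => by
    rw [hρ.eq_zero hx, hh.eq_zero (F.gradient_mem_frontier hΩ hΩ' ht hx)]
    linarith [hbar y hy])
  have hQ : Q t x (∇ h (P t x)) = (c + δ) • ∇ ρ x := by
    rw [add_smul, ← hg, sub_add_cancel]
  have h1 := norm_map_sq_le (F.symm t ht x hx.1) (F.nonneg ht hx.1) (∇ h (P t x))
  have h2 := mul_le_mul_of_nonneg_right hM (F.nonneg ht hx.1 (∇ h (P t x)))
  have h3 := h1.trans h2
  have hl : 0 < c + δ := by linarith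
  rw [hQ, norm_smul, Real.norm_of_nonneg hl.le, real_inner_smul_left] at h3
  have h4 : (c + δ) * ‖∇ ρ x‖ ^ 2 ≤ M * ⟪∇ ρ x, ∇ h (P t x)⟫ := by
    refine le_of_mul_le_mul_left ?_ hl
    linarith
  have h5 : 0 ≤ c * ‖∇ ρ x‖ ^ 2 := by positivity
  linarith

/-- The estimate for one fixed defining function `h` of `Ω'`. -/
lemma exists_forall_mul_le_inner {n : ℕ} {Ω Ω' : Set (EucSp n)}
    (hn : 0 < n) (hΩ : IsUniformlyConvexDomain Ω) (hΩ' : IsUniformlyConvexDomain Ω')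
    (hball : closure Ω' ⊆ Metric.ball (0 : EucSp n) 1) {u₀ : EucSp n → ℝ}
    (hu₀ : ContDiffOn ℝ 2 u₀ (closure Ω))
    (hconv : ∃ θ : ℝ, 0 < θ ∧ ∀ x ∈ closure Ω, ∀ ξ : EucSp n,
      θ * ‖ξ‖ ^ 2 ≤ hessOn Ω u₀ x ξ ξ)
    (hgrad : gradOn Ω u₀ '' Ω = Ω') {ρ h : EucSp n → ℝ} (hρ : IsBoundaryDefining Ω ρ)
    (hh : IsDefiningFunction Ω' h) :
    ∃ δ M : ℝ, 0 < δ ∧ 0 < M ∧ ∀ T : ℝ, 0 < T → ∀ u : ℝ → EucSp n → ℝ,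
      IsStrictlyConvexSolution Ω Ω' u₀ T u → ∀ t ∈ Icc 0 T, ∀ x ∈ frontier Ω,
        δ * ‖∇ ρ x‖ ^ 2 ≤ M * ⟪∇ ρ x, ∇ h (gradOn Ω (u t) x)⟫ := by
  have hh' := hh.isBoundaryDefining
  have hΩc := hΩ.isCompact
  have hne : (closure Ω).Nonempty := hΩ.nonempty.closure
  obtain ⟨r, hr, hr'⟩ : ∃ r : ℝ, r < 1 ∧ ∀ p ∈ closure Ω', ‖p‖ ≤ r := by
    obtain ⟨p, hp, hmax⟩ := hΩ'.isCompact.exists_isMaxOn hΩ'.nonempty.closure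
      continuous_norm.continuousOn
    exact ⟨‖p‖, by simpa using hball hp, fun q hq => isMaxOn_iff.1 hmax q hq⟩
  obtain ⟨θ, hθ, hconc⟩ := hh.concave
  have F₀ := convexFlow_initial hΩ hball hu₀ hconv hgrad
  have h00 : (0 : ℝ) ∈ Icc (0 : ℝ) 0 := left_mem_Icc.2 le_rfl
  -- bounds for the initial velocity
  set A : EucSp n → ℝ := fun x => minkOp (gradOn Ω u₀ x) (hessField Ω u₀ x) with hA
  have hAc : ContinuousOn A (closure Ω) :=
    F₀.cont_V.comp (f := fun x : EucSp n => ((0 : ℝ), x)) (by fun_prop) fun x hx => ⟨h00, hx⟩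
  have hApos : ∀ x ∈ closure Ω, 0 < A x := by
    intro x hx
    have h1 := frameTrace_le_minkOp hr (hr' _ (F₀.gradient_mem_closure h00 hx)) (F₀.nonneg h00 hx)
    refine lt_of_lt_of_le ?_ h1
    have : Nonempty (Fin n) := ⟨⟨0, hn⟩⟩
    refine Finset.sum_pos (fun i _ => F₀.pos 0 h00 x hx _ fun h0 => ?_) Finset.univ_nonempty
    have := (EuclideanSpace.basisFun (Fin n) ℝ).norm_eq_one i
    rw [h0, norm_zero] at this
    exact zero_ne_one this
  obtain ⟨m₀, hm₀, hAm⟩ := hΩc.exists_forall_le' hAc hApos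
  obtain ⟨M, hM⟩ := hΩc.exists_bound_of_continuousOn hAc
  have hAM : ∀ x ∈ closure Ω, A x ≤ M := fun x hx => (le_abs_self _).trans (hM x hx)
  obtain ⟨G, hG⟩ := hΩc.exists_bound_of_continuousOn
    (contDiff_gradient hρ.smooth).continuous.continuousOn
  obtain ⟨W, hW⟩ := hΩc.exists_bound_of_continuousOn (continuous_hessMap hρ.smooth).continuousOn
  obtain ⟨y, hy⟩ := hne
  have hMpos : 0 < M := (hApos y hy).trans_le (hAM y hy)
  have hG0 : 0 ≤ G := (norm_nonneg _).trans (hG y hy)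
  have hW0 : 0 ≤ W := (norm_nonneg _).trans (hW y hy)
  have hr2 : 0 < 1 - r ^ 2 := one_sub_sq_pos hr (hr' _ (F₀.gradient_mem_closure h00 hy))
  obtain ⟨δ₀, hδ₀, hbar₀⟩ := F₀.exists_mul_le hΩ hΩ' hρ hh' h00
  set m := m₀ * (1 - r ^ 2) with hm
  have hmpos : 0 < m := mul_pos hm₀ hr2
  set X := (n + 1 / (1 - r ^ 2)) * W + 2 * (M * G) / (1 - r ^ 2)
    + 2 * (M * G) / (1 - r ^ 2) ^ 2 with hX
  have hX0 : 0 ≤ X := by positivity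
  obtain ⟨δ, hδ, hδδ₀, hδX⟩ : ∃ δ : ℝ, 0 < δ ∧ δ ≤ δ₀ ∧ n * (δ * X) < θ * m ^ 2 := by
    refine ⟨min δ₀ (θ * m ^ 2 / (n * X + 1)), by positivity, min_le_left _ _, ?_⟩
    have h1 : min δ₀ (θ * m ^ 2 / (n * X + 1)) * (n * X) ≤ θ * m ^ 2 / (n * X + 1) * (n * X) := by
      gcongr; exact min_le_right _ _
    have h2 : θ * m ^ 2 / (n * X + 1) * (n * X) < θ * m ^ 2 := by
      rw [div_mul_eq_mul_div, div_lt_iff₀ (by positivity)]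
      have : 0 < θ * m ^ 2 := by positivity
      linarith
    linarith
  refine ⟨δ, M, hδ, hMpos, fun T hT u hu t ht x hx => ?_⟩
  have F := hu.convexFlow hΩ hball hT hu₀.continuousOn hgrad
  have h0T : (0 : ℝ) ∈ Icc 0 T := left_mem_Icc.2 hT.le
  have hinit := hu.eqOn_initial hT.le hu₀.continuousOn
  have hP0 : ∀ z ∈ closure Ω, gradOn Ω (u 0) z = gradOn Ω u₀ z := fun z hz =>
    gradOn_congr hinit hz
  have hV0 : ∀ z ∈ closure Ω, derivWithin (fun s => u s z) (Icc 0 T) 0 = A z := by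
    intro z hz
    rw [F.equation 0 h0T z hz, hP0 z hz, hessField_congr hinit hz]
  have hup : ∀ s ∈ Icc 0 T, ∀ z ∈ closure Ω, frameTrace (hessField Ω (u s) z) ≤ M := by
    intro s hs z hz
    have h1 := F.time_deriv_le hΩ hΩ' hρ hh' hr hr' hT (c := 1) (M := M) (Or.inl rfl)
      (fun z hz => by rw [hV0 z hz, one_mul]; exact hAM z hz) hs hz
    rw [one_mul, F.equation s hs z hz] at h1
    exact (frameTrace_le_minkOp hr (hr' _ (F.gradient_mem_closure hs hz)) (F.nonneg hs hz)).trans h1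
  have hlow : ∀ s ∈ Icc 0 T, ∀ z ∈ closure Ω, m ≤ frameTrace (hessField Ω (u s) z) := by
    intro s hs z hz
    have h1 := F.time_deriv_le hΩ hΩ' hρ hh' hr hr' hT (c := -1) (M := -m₀) (Or.inr rfl)
      (fun z hz => by rw [hV0 z hz]; linarith [hAm z hz]) hs hz
    rw [F.equation s hs z hz] at h1
    refine le_trans ?_ (minkOp_mul_le_frameTrace hr (hr' _ (F.gradient_mem_closure hs hz))
      (F.symm s hs z hz) (F.nonneg hs hz))
    rw [hm]
    gcongr
    linarith
  refine F.mul_le_inner hΩ hΩ' hρ hh' hδ ht hx (hup t ht x hx.1) fun z hz => ?_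
  refine F.mul_le_comp_gradient hΩ hΩ' hρ hh' hr hr' hT hθ hδ.le (fun p hp ξ => ?_) hmpos.le hlow
    hup hG hW hδX (fun s hs z hz => hu.contDiffAt_gradOn hΩ.isOpen hs hz)
    (fun s hs z hz => hu.exists_mixed_derivative hΩ.isOpen hs hz) (fun z hz => ?_) ht hz
  · rw [inner_hessMap hh.smooth]; exact hconc p hp ξ
  · rw [hP0 z hz]
    exact (mul_le_mul_of_nonneg_right hδδ₀ (hρ.nonneg hz)).trans (hbar₀ z hz)

theorem lemma3p7 {n : ℕ} (Ω Ω' : Set (EucSp n))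
    (hΩ : IsUniformlyConvexDomain Ω) (hΩ' : IsUniformlyConvexDomain Ω')
    (hball : closure Ω' ⊆ Metric.ball (0 : EucSp n) 1)
    (α₀ : ℝ) (hα₀ : 0 < α₀) (hα₀' : α₀ < 1)
    (u₀ : EucSp n → ℝ) (hu₀ : IsHolderC2 α₀ Ω u₀)
    (hconv : ∃ θ : ℝ, 0 < θ ∧ ∀ x ∈ closure Ω, ∀ ξ : EucSp n,
      θ * ‖ξ‖ ^ 2 ≤ hessOn Ω u₀ x ξ ξ)
    (hgrad : gradOn Ω u₀ '' Ω = Ω') :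
    ∃ C₁ : ℝ, 0 < C₁ ∧
      ∀ h : EucSp n → ℝ, IsDefiningFunction Ω' h →
      ∀ T : ℝ, 0 < T → ∀ u : ℝ → EucSp n → ℝ, IsStrictlyConvexSolution Ω Ω' u₀ T u →
      ∀ t ∈ Icc 0 T, ∀ x ∈ frontier Ω, ∀ ν : EucSp n, IsInwardUnitNormal Ω x ν →
        1 / C₁ ≤ ⟪∇ h (gradOn Ω (u t) x), ν⟫ := by
  by_cases hex : ∃ h₀, IsDefiningFunction Ω' h₀
  swap
  · exact ⟨1, one_pos, fun h hh => absurd ⟨h, hh⟩ hex⟩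
  rcases Nat.eq_zero_or_pos n with rfl | hn
  · -- a nonempty set in a one-point space has no boundary
    refine ⟨1, one_pos, fun h hh T hT u hu t ht x hx => ?_⟩
    rw [Subsingleton.eq_univ_of_nonempty hΩ.nonempty, frontier_univ] at hx
    exact absurd hx (notMem_empty x)
  obtain ⟨h₀, hh₀⟩ := hex
  obtain ⟨ρ, hρ, -⟩ := hΩ.curvature
  obtain ⟨δ, M, hδ, hM, hmain⟩ :=
    exists_forall_mul_le_inner hn hΩ hΩ' hball hu₀.1 hconv hgrad hρ hh₀
  have hfr : IsCompact (frontier Ω) := hΩ.isCompact.of_isClosed_subset isClosed_frontier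
    frontier_subset_closure
  obtain ⟨k, hk, hkρ⟩ := hfr.exists_forall_le'
    (contDiff_gradient hρ.smooth).continuous.norm.continuousOn
    fun x hx => norm_pos_iff.2 (hρ.grad_ne x hx)
  refine ⟨M / (δ * k), by positivity, fun h hh T hT u hu t ht x hx ν hν => ?_⟩
  obtain ⟨ρ', hρ', rfl⟩ := hν
  have F := hu.convexFlow hΩ hball hT hu₀.1.continuousOn hgrad
  have hP := F.gradient_mem_frontier hΩ hΩ' ht hx
  have hβ : ∇ h (gradOn Ω (u t) x) = ∇ h₀ (gradOn Ω (u t) x) := by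
    have := hh₀.isBoundaryDefining.normal_unique hh.isBoundaryDefining hP
    rwa [hh.norm_grad _ hP, hh₀.norm_grad _ hP, inv_one, one_smul, one_smul] at this
  have h1 := hmain T hT u hu t ht x hx
  have hn0 : 0 < ‖∇ ρ x‖ := hk.trans_le (hkρ x hx)
  rw [hρ.normal_unique hρ' hx, hβ, real_inner_smul_right, real_inner_comm, one_div_div,
    div_le_iff₀ hM, inv_mul_eq_div, div_mul_eq_mul_div, le_div_iff₀ hn0]
  have h2 : δ * k * ‖∇ ρ x‖ ≤ δ * ‖∇ ρ x‖ * ‖∇ ρ x‖ := by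
    gcongr; exact hkρ x hx
  linarith
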